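/- Let $k$ be a field, and for $m\ge 0$ let $[m]$ be the poset $\{0<1<\dots<m\}$, regarded as a category. For a small category $\mathcal D$, a $k\mathcal D$-module is a functor from $\mathcal D$ to finite-dimensional $k$-vector spaces, and $\mathrm{Gr}(k\mathcal D)$ denotes the split Grothendieck group of $k\mathcal D$-modules, i.e. the group completion of the commutative monoid of isomorphism classes of $k\mathcal D$-modules under direct sum. For a simplicial object $\mathcal D_\bullet$ in small categories, with face functors $\partial_i$, the representation cohomology $\mathscr R^*(\mathcal D_\bullet,k)$ is the cohomology of the cochain complex $\mathrm{Gr}(k\mathcal D_0)\to \mathrm{Gr}(k\mathcal D_1)\to\cdots$ with coboundary $d=\sum_i(-1)^i\delta^i$, where $\delta^i[M]=[M\circ\partial_i]$. For a small category $\mathcal C$, let $\widetilde{\mathcal E}^{\mathcal C}_\bullet$ be the simplicial object in small categories with $\widetilde{\mathcal E}^{\mathcal C}_m=\mathcal C^{[m]}$ (the functor category) and simplicial operators given by precomposition. Let $\widetilde{\mathcal G}^{\mathcal C}_\bullet\subseteq\widetilde{\mathcal E}^{\mathcal C}_\bullet$ be the simplicial subobject with the same objects in each dimension, whose morphisms $\underline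 x\to\underline y$ in dimension $m$ are the identities and those natural transformations that are induced by a morphism $g\colon x_m\to y_0$ of $\mathcal C$, i.e. whose $i$-th component is the composite $x_i\to x_m\xrightarrow{g}y_0\to y_i$ for every $i$. Put $\widetilde{\mathbf E}^*(\mathcal C,k)=\mathscr R^*(\widetilde{\mathcal E}^{\mathcal C}_\bullet,k)$ and $\widetilde{\mathbf G}^*(\mathcal C,k)=\mathscr R^*(\widetilde{\mathcal G}^{\mathcal C}_\bullet,k)$. Then for every $n\ge 2$ there are isomorphisms of abelian groups \[ \widetilde{\mathbf E}^i([n],k)\cong\begin{cases}\mathbb Z & i=0,\\ 0 & i>0,\end{cases} \qquad\text{and}\qquad \widetilde{\mathbf G}^i([n],k)\cong\begin{cases}\mathbb Z & i=0,\\ \mathbb Z^n & i=1,\\ 0 & i>1.\end{cases} \] -/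

import Mathlib

open CategoryTheory CategoryTheory.Limits

universe u v w

namespace RepCohomology

noncomputable section

/-! ### The split Grothendieck group of an additive category -/

section SplitGrothendieck

variable (A : Type w) [Category.{v} A]

/-- Isomorphism classes of objects of `A`. -/
def IsoClass : Type w := Quotient (isIsomorphicSetoid A)

variable {A}

/-- The isomorphism class of an object. -/
def IsoClass.mk (X : A) : IsoClass A := Quotient.mk (isIsomorphicSetoid A) X

theorem IsoClass.mk_eq_mk_iff {X Y : A} :
    IsoClass.mk X = IsoClass.mk Y ↔ Nonempty (X ≅ Y) :=
  ⟨fun h => Quotient.exact (s := isIsomorphicSetoid A) h,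
    fun h => Quotient.sound (s := isIsomorphicSetoid A) h⟩

theorem IsoClass.ind {p : IsoClass A → Prop} (h : ∀ X : A, p (IsoClass.mk X))
    (x : IsoClass A) : p x :=
  Quotient.ind (s := isIsomorphicSetoid A) h x

variable [Preadditive A] [HasZeroObject A] [HasBinaryBiproducts A]

open scoped ZeroObject

instance : Zero (IsoClass A) := ⟨IsoClass.mk (0 : A)⟩

/-- Addition of isomorphism classes is induced by the biproduct. -/
instance : Add (IsoClass A) :=
  ⟨Quotient.map₂ (sa := isIsomorphicSetoid A) (sb := isIsomorphicSetoid A)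
    (sc := isIsomorphicSetoid A) (fun X Y => X ⊞ Y)
    (fun _ _ ⟨e⟩ _ _ ⟨f⟩ => ⟨biprod.mapIso e f⟩)⟩

instance : AddCommMonoid (IsoClass A) where
  add_assoc x y z := by
    induction x using IsoClass.ind with | _ X
    induction y using IsoClass.ind with | _ Y
    induction z using IsoClass.ind with | _ Z
    exact IsoClass.mk_eq_mk_iff.2 ⟨biprod.associator X Y Z⟩
  zero_add x := by
    induction x using IsoClass.ind with | _ X
    exact IsoClass.mk_eq_mk_iff.2 ⟨(isoZeroBiprod (isZero_zero A)).symm⟩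
  add_zero x := by
    induction x using IsoClass.ind with | _ X
    exact IsoClass.mk_eq_mk_iff.2 ⟨(isoBiprodZero (isZero_zero A)).symm⟩
  add_comm x y := by
    induction x using IsoClass.ind with | _ X
    induction y using IsoClass.ind with | _ Y
    exact IsoClass.mk_eq_mk_iff.2 ⟨biprod.braiding X Y⟩
  nsmul := nsmulRec

variable (A) in
/-- The (split) Grothendieck group of an additive category: the group completion of the
commutative monoid of isomorphism classes of objects under the biproduct. -/
abbrev SplitGr : Type w := Algebra.GrothendieckAddGroup (IsoClass A)

variable {B : Type*} [Category* B] [Preadditive B] [HasZeroObject B] [HasBinaryBiproducts B]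

/-- The additive map on isomorphism classes, `[X] ↦ [F X]`, induced by an additive functor. -/
def IsoClass.map (F : A ⥤ B) [F.Additive] : IsoClass A →+ IsoClass B where
  toFun := Quotient.map (sa := isIsomorphicSetoid A) (sb := isIsomorphicSetoid B)
    F.obj (fun _ _ ⟨e⟩ => ⟨F.mapIso e⟩)
  map_zero' := IsoClass.mk_eq_mk_iff.2 ⟨F.mapZeroObject⟩
  map_add' x y := by
    induction x using IsoClass.ind with | _ X
    induction y using IsoClass.ind with | _ Y
    have := preservesBinaryBiproducts_of_preservesBiproducts F
    exact IsoClass.mk_eq_mk_iff.2 ⟨F.mapBiprod X Y⟩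

theorem IsoClass.map_mk (F : A ⥤ B) [F.Additive] (X : A) :
    IsoClass.map F (IsoClass.mk X) = IsoClass.mk (F.obj X) := rfl

/-- The homomorphism of Grothendieck groups, `[X] ↦ [F X]`, induced by an additive functor. -/
def SplitGr.map (F : A ⥤ B) [F.Additive] : SplitGr A →+ SplitGr B :=
  Algebra.GrothendieckAddGroup.lift
    ((Algebra.GrothendieckAddGroup.of (M := IsoClass B)).comp (IsoClass.map F))

theorem SplitGr.map_of (F : A ⥤ B) [F.Additive] (X : A) :
    SplitGr.map F (Algebra.GrothendieckAddGroup.of (IsoClass.mk X)) =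
      Algebra.GrothendieckAddGroup.of (IsoClass.mk (F.obj X)) :=
  DFunLike.congr_fun (Algebra.GrothendieckAddGroup.lift.symm_apply_apply
    ((Algebra.GrothendieckAddGroup.of (M := IsoClass B)).comp (IsoClass.map F)))
    (IsoClass.mk X)

theorem SplitGr.hom_ext {G : Type*} [AddCommGroup G] {f g : SplitGr A →+ G}
    (h : ∀ X : A, f (Algebra.GrothendieckAddGroup.of (IsoClass.mk X)) =
      g (Algebra.GrothendieckAddGroup.of (IsoClass.mk X))) : f = g :=
  Algebra.GrothendieckAddGroup.lift.symm.injective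
    (AddMonoidHom.ext (IsoClass.ind (p := fun x =>
      f (Algebra.GrothendieckAddGroup.of x) = g (Algebra.GrothendieckAddGroup.of x)) h))

theorem SplitGr.map_id : SplitGr.map (𝟭 A) = AddMonoidHom.id (SplitGr A) :=
  SplitGr.hom_ext fun X => SplitGr.map_of (𝟭 A) X

theorem SplitGr.map_comp {D : Type*} [Category* D] [Preadditive D] [HasZeroObject D]
    [HasBinaryBiproducts D] (F : A ⥤ B) (G : B ⥤ D) [F.Additive] [G.Additive] :
    SplitGr.map (F ⋙ G) = (SplitGr.map G).comp (SplitGr.map F) :=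
  SplitGr.hom_ext fun X => by
    rw [SplitGr.map_of, AddMonoidHom.comp_apply, SplitGr.map_of, SplitGr.map_of]
    rfl

end SplitGrothendieck

/-! ### Modules over a small category and representation cohomology -/

/-- The category of `kC`-modules: functors from `C` to finite dimensional `k`-vector spaces. -/
abbrev CatMod (k : Type u) [Field k] (C : Type w) [Category.{v} C] :=
  C ⥤ FGModuleCat.{u} k

/-- The contravariant functor `C ↦ Gr(kC)` on small categories; a functor `F : C ⥤ D` is sent to
`[M] ↦ [F ⋙ M]`. -/
def grFunctor (k : Type u) [Field k] :
    Cat.{v, w}ᵒᵖ ⥤ AddCommGrpCat.{max u v w (u + 1)} where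
  obj C := AddCommGrpCat.of (SplitGr (CatMod k C.unop))
  map F := AddCommGrpCat.ofHom
    (SplitGr.map ((Functor.whiskeringLeft _ _ (FGModuleCat.{u} k)).obj F.unop.toFunctor))
  map_id C := congrArg AddCommGrpCat.ofHom (SplitGr.map_id (A := CatMod k C.unop))
  map_comp F G := congrArg AddCommGrpCat.ofHom (SplitGr.map_comp
    ((Functor.whiskeringLeft _ _ (FGModuleCat.{u} k)).obj F.unop.toFunctor)
    ((Functor.whiskeringLeft _ _ (FGModuleCat.{u} k)).obj G.unop.toFunctor))

/-- The cosimplicial abelian group `Gr(kX_•)` of a simplicial object `X_•` in small categories. -/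
def grCosimplicial (k : Type u) [Field k] (X : SimplicialObject Cat.{v, w}) :
    CosimplicialObject AddCommGrpCat.{max u v w (u + 1)} :=
  Functor.rightOp X ⋙ grFunctor k

/-- The cochain complex `Gr(kX_•)`, with coboundary the alternating sum of the cofaces. -/
def repComplex (k : Type u) [Field k] (X : SimplicialObject Cat.{v, w}) :
    CochainComplex AddCommGrpCat.{max u v w (u + 1)} ℕ :=
  (AlgebraicTopology.alternatingCofaceMapComplex _).obj (grCosimplicial k X)

/-- The `i`-th representation cohomology group of `X_•` over `k`. -/
def repCohomology (k : Type u) [Field k] (X : SimplicialObject Cat.{v, w}) (i : ℕ) :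
    AddCommGrpCat.{max u v w (u + 1)} :=
  (repComplex k X).homology i

/-! ### The two simplicial envelopes of a small category -/

section Envelopes

variable (C : Type w) [Category.{v} C]

/-- The simplicial envelope of `C`: in dimension `m` it is the functor category `C^[m]`, and the
simplicial operators are given by precomposition. -/
def envelope : SimplicialObject Cat.{v, max v w} where
  obj m := Cat.of (ComposableArrows C m.unop.len)
  map α := (ComposableArrows.whiskerLeftFunctor
    α.unop.toOrderHom.monotone.functor).toCatHom
  map_id _ := rfl
  map_comp _ _ := rfl

variable {C}

/-- The morphism `x ⟶ y` of `C^[m]` induced by a morphism `g : x_m ⟶ y_0` of `C`: its `i`-th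
component is the composite `x_i ⟶ x_m ⟶ y_0 ⟶ y_i`. -/
def inducedHom {m : ℕ} {x y : ComposableArrows C m}
    (g : x.obj (Fin.last m) ⟶ y.obj 0) : x ⟶ y where
  app i := x.map (homOfLE (Fin.le_last i)) ≫ g ≫ y.map (homOfLE (Fin.zero_le i))
  naturality i j f := by
    simp only [Category.assoc, ← Functor.map_comp, ← Functor.map_comp_assoc]
    rfl

theorem inducedHom_comp {m : ℕ} {x y z : ComposableArrows C m}
    (a : x.obj (Fin.last m) ⟶ y.obj 0) (b : y.obj (Fin.last m) ⟶ z.obj 0) :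
    inducedHom a ≫ inducedHom b =
      inducedHom (a ≫ y.map (homOfLE (Fin.zero_le (Fin.last m))) ≫ b) := by
  ext i
  simp only [inducedHom, NatTrans.comp_app, Category.assoc, ← Functor.map_comp_assoc]
  rfl

variable (C)

/-- The morphisms of `C^[m]` that belong to the compositional envelope: the identities, and the
morphisms `x ⟶ y` induced by a morphism `x_m ⟶ y_0`. -/
inductive compositional (m : ℕ) : MorphismProperty (ComposableArrows C m)
  | id (x : ComposableArrows C m) : compositional m (𝟙 x)
  | induced {x y : ComposableArrows C m} (g : x.obj (Fin.last m) ⟶ y.obj 0) :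
      compositional m (inducedHom g)

instance (m : ℕ) : (compositional C m).IsMultiplicative where
  id_mem x := .id x
  comp_mem f g hf hg := by
    cases hf with
    | id => rwa [Category.id_comp]
    | induced a =>
      cases hg with
      | id => rw [Category.comp_id]; exact .induced a
      | induced b => rw [inducedHom_comp]; exact .induced _

variable {C}

theorem compositional_whiskerLeft {m n : ℕ} (Φ : Fin (n + 1) ⥤ Fin (m + 1))
    {x y : ComposableArrows C m} {f : x ⟶ y} (hf : compositional C m f) :
    compositional C n ((ComposableArrows.whiskerLeftFunctor Φ).map f) := by
  cases hf with
  | id => exact .id (x.whiskerLeft Φ)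
  | induced g =>
    have : (ComposableArrows.whiskerLeftFunctor Φ).map (inducedHom g) =
        inducedHom (x := x.whiskerLeft Φ) (y := y.whiskerLeft Φ)
          (x.map (homOfLE (Fin.le_last _)) ≫ g ≫ y.map (homOfLE (Fin.zero_le _))) := by
      ext i
      simp only [inducedHom, ComposableArrows.whiskerLeftFunctor, Functor.whiskerLeft_app,
        ComposableArrows.whiskerLeft, Functor.comp_map, Category.assoc,
        ← Functor.map_comp, ← Functor.map_comp_assoc]
      rfl
    rw [this]
    exact .induced _

variable (C)

/-- The compositional simplicial envelope of `C`: the simplicial subobject of the simplicial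
envelope with the same objects, and with the compositional morphisms only. -/
def compEnvelope : SimplicialObject Cat.{v, max v w} where
  obj m := Cat.of (WideSubcategory (compositional C m.unop.len))
  map α := Functor.toCatHom
    { obj := fun x => ⟨(ComposableArrows.whiskerLeftFunctor
        α.unop.toOrderHom.monotone.functor).obj x.obj⟩
      map := fun f => ⟨(ComposableArrows.whiskerLeftFunctor
        α.unop.toOrderHom.monotone.functor).map f.hom,
          compositional_whiskerLeft _ f.property⟩
      map_id := fun _ => rfl
      map_comp := fun _ _ => rfl }
  map_id _ := rfl
  map_comp _ _ := rfl

/-- The cohomology `Ẽ^i(C, k)`. -/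
abbrev envelopeCohomology (k : Type u) [Field k] (i : ℕ) :=
  repCohomology k (envelope C) i

/-- The cohomology `G̃^i(C, k)`. -/
abbrev compEnvelopeCohomology (k : Type u) [Field k] (i : ℕ) :=
  repCohomology k (compEnvelope C) i

end Envelopes

end

end RepCohomology

namespace RepCohomology

noncomputable section

/-! ### The Krull-Schmidt theorem for split Grothendieck groups -/

section KrullSchmidt

variable {B : Type w} [Category.{v} B]

/-! For the full envelope, prepending the least element of `[n]` to a tuple is a functor and an
extra degeneracy. It contracts the complex (`subsingleton_envelopeCohomology`) and turns a 0-cocycle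
into a multiple of the constant class.

For the compositional envelope, prepending need not send induced morphisms to induced ones, so the
complex is cut in two. Modules in dimension `m` are taken modulo the maps that vanish on restriction
to dimension zero along the total degeneracy. In the quotient the cofaces are fully faithful, so
they preserve and reflect local endomorphism rings. By Krull-Schmidt the local classes form a basis
of each reduced Grothendieck group; the cofaces carry basis elements to basis elements, and deleting
`δ 0` is a contraction in positive degrees (`exact_of_basis`).

The kernel of reduction consists of differences of modules that vanish on the constant tuples. Every
non-identity morphism factors through a constant tuple, so such modules are determined by their
dimensions, and the kernel is the complex of integer functions on tuples that vanish on constant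
ones. All functions on tuples form a complex contracted by prepending, while the functions on
constant tuples form `ℤ^(n+1)` in each degree with differentials `0, 1, 0, 1, …`. The kernel
therefore has only `H^1`, equal to `ℤ^(n+1)/ℤ`.

The two parts are glued in low degree: reduced 0-cocycles are multiples of the constant class
(`isIso_map_fromZero`), hence lift to true cocycles. So the connecting map into `H^1` is zero, `H^0`
is `ℤ`, and `H^1` is `ℤ^n`. -/

theorem isIso_of_isUnit_end {X : B} {f : X ⟶ X} (h : IsUnit (M := End X) f) : IsIso f :=
  (isUnit_iff_isIso f).1 h

theorem IsoClass.exists_rep (t : IsoClass B) : ∃ X : B, IsoClass.mk X = t :=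
  IsoClass.ind (p := fun t => ∃ X : B, IsoClass.mk X = t) (fun X => ⟨X, rfl⟩) t

variable [Preadditive B]

theorem id_eq_zero_of_isIso {X : B} (f : X ⟶ X) [IsIso f] (h : f = 0) : 𝟙 X = 0 := by
  subst h
  rw [← IsIso.hom_inv_id (0 : X ⟶ X), zero_comp]

/-- In a category with a local endomorphism ring at `Y`, a retract datum `X ⟶ Y ⟶ X` with `X`
nonzero consists of isomorphisms. -/
theorem isIso_of_comp_isIso_of_isLocalRing {X Y : B} [IsLocalRing (End Y)] [Nontrivial (End X)]
    (f : X ⟶ Y) (g : Y ⟶ X) (h : IsIso (f ≫ g)) : IsIso f := by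
  -- This endomorphism is idempotent, and in a local ring `e` or `1 - e` is a unit. The first forces
  -- `e = 1`; the second forces `e = 0`, hence `f = 0`, against `X` being nonzero.
  let e : Y ⟶ Y := g ≫ inv (f ≫ g) ≫ f
  have he : f ≫ e = f := by simp [e, ← Category.assoc]
  have hee : e ≫ e = e := by
    have : e ≫ e = g ≫ inv (f ≫ g) ≫ (f ≫ e) := by simp only [e, Category.assoc]
    rw [this, he]
  have hadd : (show End Y from e) + (show End Y from (𝟙 Y - e)) = 1 :=
    add_sub_cancel e (𝟙 Y)
  rcases IsLocalRing.isUnit_or_isUnit_of_add_one hadd with h1 | h1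
  · have := isIso_of_isUnit_end h1
    have h2 : e = 𝟙 Y := by rw [← cancel_epi e, hee, Category.comp_id]
    refine ⟨g ≫ inv (f ≫ g), ?_, ?_⟩
    · rw [← Category.assoc, IsIso.hom_inv_id]
    · rw [Category.assoc]; exact h2
  · have := isIso_of_isUnit_end h1
    have h2 : e = 0 := by
      rw [← cancel_epi (𝟙 Y - e), Preadditive.sub_comp, Category.id_comp, hee, sub_self, comp_zero]
    have h3 : f = 0 := by rw [← he, h2, comp_zero]
    exact (one_ne_zero (α := End X) (id_eq_zero_of_isIso (f ≫ g) (by rw [h3, zero_comp]))).elim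

variable [HasZeroObject B] [HasBinaryBiproducts B]

omit [HasZeroObject B] in
theorem IsoClass.mk_biprod (X Y : B) :
    IsoClass.mk (X ⊞ Y) = IsoClass.mk X + IsoClass.mk Y := rfl

omit [Preadditive B] [HasBinaryBiproducts B] in
theorem IsoClass.mk_eq_zero {X : B} (h : IsZero X) : IsoClass.mk X = 0 :=
  IsoClass.mk_eq_mk_iff.2 ⟨h.iso (isZero_zero B)⟩

omit [Preadditive B] [HasBinaryBiproducts B] in
theorem IsoClass.isZero_of_mk_eq_zero {X : B} (h : IsoClass.mk X = 0) : IsZero X :=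
  (isZero_zero B).of_iso (IsoClass.mk_eq_mk_iff.1 h).some

/-- The classes of the objects with a local endomorphism ring. -/
def IsoClass.IsLocal (c : IsoClass B) : Prop := ∃ X : B, IsoClass.mk X = c ∧ IsLocalRing (End X)

/-- If `X` is local and a retract of a finite sum of local objects, then it is isomorphic to one of
the summands. -/
theorem exists_summand_of_retract {X : B} [IsLocalRing (End X)] (t : Multiset (IsoClass B)) :
    (∀ c ∈ t, IsoClass.IsLocal c) → ∀ (Z : B), IsoClass.mk Z = t.sum →
    ∀ (c : X ⟶ Z) (d : Z ⟶ X), IsIso (c ≫ d) →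
    ∃ (t' : Multiset (IsoClass B)) (Z' : B) (ψ : Z ≅ X ⊞ Z'), t = IsoClass.mk X ::ₘ t' ∧
      IsoClass.mk Z' = t'.sum ∧ IsIso (c ≫ ψ.hom ≫ biprod.fst) := by
  induction t using Multiset.induction with
  | empty =>
    intro _ Z hZ c d hcd
    have hZ0 : IsZero Z := IsoClass.isZero_of_mk_eq_zero (by simpa using hZ)
    exact (one_ne_zero (α := End X) (id_eq_zero_of_isIso (c ≫ d)
      (by rw [hZ0.eq_of_tgt c 0, zero_comp]))).elim
  | cons a t ih =>
    intro ht Z hZ c d hcd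
    obtain ⟨Y, rfl, hY⟩ := ht a (Multiset.mem_cons_self a t)
    obtain ⟨Z₁, hZ₁⟩ := IsoClass.exists_rep t.sum
    rw [Multiset.sum_cons, ← hZ₁, ← IsoClass.mk_biprod] at hZ
    obtain ⟨e⟩ := IsoClass.mk_eq_mk_iff.1 hZ
    -- The isomorphism `c ≫ d` is the sum of its parts through `Y` and through `Z₁`. One of them is
    -- a unit because `End X` is local.
    have hsum : (show End X from ((c ≫ e.hom ≫ biprod.fst) ≫ (biprod.inl ≫ e.inv ≫ d))) +
        (show End X from ((c ≫ e.hom ≫ biprod.snd) ≫ (biprod.inr ≫ e.inv ≫ d))) = c ≫ d := by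
      have h := congrArg (fun s => c ≫ e.hom ≫ s ≫ e.inv ≫ d) (biprod.total (X := Y) (Y := Z₁))
      simp only [Category.id_comp, Iso.hom_inv_id_assoc, Preadditive.add_comp,
        Preadditive.comp_add, Category.assoc] at h
      simpa only [Category.assoc] using h
    have hunit : IsUnit ((show End X from ((c ≫ e.hom ≫ biprod.fst) ≫ (biprod.inl ≫ e.inv ≫ d))) +
        (show End X from ((c ≫ e.hom ≫ biprod.snd) ≫ (biprod.inr ≫ e.inv ≫ d)))) := by
      rw [hsum]; exact (isUnit_iff_isIso (c ≫ d)).2 hcd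
    rcases IsLocalRing.isUnit_or_isUnit_of_isUnit_add hunit with h1 | h1
    · have hu := isIso_of_comp_isIso_of_isLocalRing (c ≫ e.hom ≫ biprod.fst)
        (biprod.inl ≫ e.inv ≫ d) (isIso_of_isUnit_end h1)
      refine ⟨t, Z₁, e ≪≫ biprod.mapIso (asIso (c ≫ e.hom ≫ biprod.fst)).symm (Iso.refl Z₁), ?_,
        hZ₁, ?_⟩
      · rw [IsoClass.mk_eq_mk_iff.2 ⟨asIso (c ≫ e.hom ≫ biprod.fst)⟩]
      · have : c ≫ (e ≪≫ biprod.mapIso (asIso (c ≫ e.hom ≫ biprod.fst)).symm (Iso.refl Z₁)).hom ≫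
            biprod.fst = 𝟙 X := by
          have h2 := IsIso.hom_inv_id (c ≫ e.hom ≫ biprod.fst)
          simp only [Category.assoc] at h2
          simp [h2]
        rw [this]; infer_instance
    · obtain ⟨t', Z', ψ, rfl, hZ', hψ⟩ := ih (fun c hc => ht c (Multiset.mem_cons_of_mem hc)) Z₁
        hZ₁ (c ≫ e.hom ≫ biprod.snd) (biprod.inr ≫ e.inv ≫ d) (isIso_of_isUnit_end h1)
      refine ⟨IsoClass.mk Y ::ₘ t', Y ⊞ Z', e ≪≫ biprod.mapIso (Iso.refl Y) ψ ≪≫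
        (biprod.associator Y X Z').symm ≪≫ biprod.mapIso (biprod.braiding Y X) (Iso.refl Z') ≪≫
        biprod.associator X Y Z', Multiset.cons_swap _ _ _, ?_, ?_⟩
      · rw [IsoClass.mk_biprod, hZ', Multiset.sum_cons]
      · have : c ≫ (e ≪≫ biprod.mapIso (Iso.refl Y) ψ ≪≫
            (biprod.associator Y X Z').symm ≪≫ biprod.mapIso (biprod.braiding Y X) (Iso.refl Z') ≪≫
            biprod.associator X Y Z').hom ≫ biprod.fst =
            (c ≫ e.hom ≫ biprod.snd) ≫ ψ.hom ≫ biprod.fst := by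
          simp [biprod.associator, biprod.braiding]
        rw [this]; exact hψ

/-- The Krull-Schmidt theorem: decompositions into local objects are unique. -/
theorem multiset_eq_of_sum_eq (s : Multiset (IsoClass B)) :
    (∀ c ∈ s, IsoClass.IsLocal c) → ∀ t : Multiset (IsoClass B),
      (∀ c ∈ t, IsoClass.IsLocal c) → s.sum = t.sum → s = t := by
  induction s using Multiset.induction with
  | empty =>
    intro _ t ht h
    induction t using Multiset.induction with
    | empty => rfl
    | cons a t _ =>
      obtain ⟨Y, rfl, hY⟩ := ht a (Multiset.mem_cons_self a t)
      obtain ⟨Z, hZ⟩ := IsoClass.exists_rep t.sum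
      rw [Multiset.sum_zero, Multiset.sum_cons, ← hZ, ← IsoClass.mk_biprod] at h
      have h0 := IsoClass.isZero_of_mk_eq_zero h.symm
      have h4 : 𝟙 Y = 0 := by
        rw [← biprod.inl_fst (X := Y) (Y := Z), h0.eq_of_tgt biprod.inl 0, zero_comp]
      exact (one_ne_zero (α := End Y) h4).elim
  | cons a s ih =>
    intro hs t ht h
    obtain ⟨X, rfl, hX⟩ := hs a (Multiset.mem_cons_self a s)
    obtain ⟨A, hA⟩ := IsoClass.exists_rep s.sum
    obtain ⟨Z, hZ⟩ := IsoClass.exists_rep t.sum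
    rw [Multiset.sum_cons, ← hA, ← hZ, ← IsoClass.mk_biprod] at h
    obtain ⟨φ⟩ := IsoClass.mk_eq_mk_iff.1 h
    obtain ⟨t', Z', ψ, rfl, hZ', hψ⟩ := exists_summand_of_retract t ht Z hZ
      (biprod.inl ≫ φ.hom) (φ.inv ≫ biprod.fst) (by simp; infer_instance)
    have : IsIso (biprod.inl ≫ (φ ≪≫ ψ).hom ≫ biprod.fst) := by
      simpa only [Iso.trans_hom, Category.assoc] using hψ
    -- The extra clause of `exists_summand_of_retract` makes the `X`-to-`X` entry of `X ⊞ A ≅ X ⊞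
    -- Z'` invertible, so Gaussian elimination cancels `X`.
    have hAZ : IsoClass.mk A = IsoClass.mk Z' :=
      IsoClass.mk_eq_mk_iff.2 ⟨Biprod.isoElim (φ ≪≫ ψ)⟩
    rw [ih (fun c hc => hs c (Multiset.mem_cons_of_mem hc)) t'
      (fun c hc => ht c (Multiset.mem_cons_of_mem hc)) (by rw [← hA, hAZ, hZ'])]

variable (B) in
/-- A category is Krull-Schmidt if each object is a finite sum of objects with local endomorphism
rings. -/
def IsKrullSchmidt : Prop :=
  ∀ c : IsoClass B, ∃ s : Multiset (IsoClass B), (∀ a ∈ s, IsoClass.IsLocal a) ∧ s.sum = c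

variable (B) in
/-- The classes of local objects. -/
abbrev LocalClass : Type w := {c : IsoClass B // IsoClass.IsLocal c}

variable (B) in
/-- The sum of a multiset of local classes. -/
def localSum : Multiset (LocalClass B) →+ IsoClass B :=
  (Multiset.sumAddMonoidHom).comp (Multiset.mapAddMonoidHom Subtype.val)

theorem localSum_bijective (h : IsKrullSchmidt B) : Function.Bijective (localSum B) := by
  constructor
  · intro s t hst
    refine Multiset.map_injective Subtype.val_injective (multiset_eq_of_sum_eq _ ?_ _ ?_ hst) <;>
    · intro c hc
      obtain ⟨a, -, rfl⟩ := Multiset.mem_map.1 hc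
      exact a.2
  · intro c
    obtain ⟨s, hs, rfl⟩ := h c
    refine ⟨s.attach.map fun a => ⟨a.1, hs a.1 a.2⟩, ?_⟩
    simp [localSum]

/-- In a Krull-Schmidt category the classes of the local objects form a basis of the split
Grothendieck group. -/
def localBasis (h : IsKrullSchmidt B) : Module.Basis (LocalClass B) ℤ (SplitGr B) := by
  classical
  let φ : (LocalClass B →₀ ℤ) →+ SplitGr B := Finsupp.liftAddHom fun c =>
    (zmultiplesHom _ (Algebra.GrothendieckAddGroup.of c.1 : SplitGr B))
  let e := AddEquiv.ofBijective (localSum B) (localSum_bijective h)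
  -- The inverse records multiplicities: an isomorphism class is read as its unique multiset of
  -- local summands.
  let ψ : SplitGr B →+ (LocalClass B →₀ ℤ) := Algebra.GrothendieckAddGroup.lift
    ((Finsupp.mapRange.addMonoidHom (Nat.castAddMonoidHom ℤ)).comp
      ((Multiset.toFinsupp (α := LocalClass B)).toAddMonoidHom.comp e.symm.toAddMonoidHom))
  have hψ : ∀ x : IsoClass B, ψ (Algebra.GrothendieckAddGroup.of x) =
      Finsupp.mapRange.addMonoidHom (Nat.castAddMonoidHom ℤ)
        (Multiset.toFinsupp (e.symm x)) :=
    fun x => DFunLike.congr_fun (Algebra.GrothendieckAddGroup.lift.symm_apply_apply _) x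
  have hφ : ∀ c, φ (Finsupp.single c 1) = Algebra.GrothendieckAddGroup.of c.1 := fun c => by
    simp [φ]
  have hψφ : ψ.comp φ = AddMonoidHom.id _ := by
    refine Finsupp.addHom_ext' fun c => AddMonoidHom.ext_int ?_
    have : e.symm c.1 = {c} := by
      rw [AddEquiv.symm_apply_eq]; simp [e, localSum]
    simp only [AddMonoidHom.comp_apply, Finsupp.singleAddHom_apply, hφ, hψ, this,
      AddMonoidHom.id_apply]
    simp
  have hφψ : φ.comp ψ = AddMonoidHom.id _ := by
    refine SplitGr.hom_ext fun X => ?_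
    obtain ⟨s, hs⟩ := e.surjective (IsoClass.mk X)
    rw [← hs]
    clear hs
    induction s using Multiset.induction with
    | empty => simp
    | cons c s ih =>
      have hc : e {c} = c.1 := by simp [e, localSum]
      rw [← Multiset.singleton_add, map_add, map_add, map_add, ih, map_add, hc,
        AddMonoidHom.comp_apply, hψ, ← hc, AddEquiv.symm_apply_apply, hc]
      congr 1
      simp [hφ]
  exact Module.Basis.ofRepr (AddEquiv.toIntLinearEquiv
    (AddMonoidHom.toAddEquiv ψ φ hφψ hψφ))

theorem localBasis_apply (h : IsKrullSchmidt B) (c : LocalClass B) :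
    localBasis h c = Algebra.GrothendieckAddGroup.of c.1 := by
  simp [localBasis]

end KrullSchmidt

/-! ### Fitting decompositions -/

section Fitting

/-- Fitting's lemma for an element of a finite dimensional algebra: `a` is an idempotent commuting
with `f`, and `f` is nilpotent on `a` and invertible on `1 - a`. -/
theorem exists_fitting_idempotent (k : Type*) {R : Type*} [Field k] [Ring R] [Algebra k R]
    [Module.Finite k R] (f : R) :
    ∃ (a g : R) (N : ℕ), a * a = a ∧ f * a = a * f ∧ f ^ N * a = 0 ∧
      (1 - a) * g = g ∧ g * (1 - a) = g ∧ f * g = 1 - a ∧ g * f = 1 - a := by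
  -- Fitting for left multiplication by `f` on the algebra itself. The idempotent `a` is the kernel
  -- component of `1`, and every identity below follows from uniqueness of the decomposition
  -- (`key`). Positivity of `N` lets one factor of `f` be peeled off to invert `f` on `1 - a`.
  have hev := (LinearMap.mulLeft k f).eventually_isCompl_ker_pow_range_pow
  obtain ⟨N, hN, hN0⟩ := (hev.and (Filter.eventually_gt_atTop 0)).exists
  rw [LinearMap.pow_mulLeft] at hN
  have key : ∀ x y : R, f ^ N * x = 0 → (∃ z, f ^ N * z = y) → x + y = 0 → x = 0 ∧ y = 0 := by
    rintro x y hx ⟨z, rfl⟩ hxy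
    have h1 : x ∈ LinearMap.ker (LinearMap.mulLeft k (f ^ N)) := hx
    have h2 : x ∈ LinearMap.range (LinearMap.mulLeft k (f ^ N)) :=
      ⟨-z, by rw [LinearMap.mulLeft_apply, mul_neg, ← eq_neg_of_add_eq_zero_left hxy]⟩
    have h3 : x = 0 := by
      have := hN.disjoint.le_bot ⟨h1, h2⟩
      simpa using this
    exact ⟨h3, by rwa [h3, zero_add] at hxy⟩
  obtain ⟨a, ha, b, ⟨c, hc⟩, hab⟩ := Submodule.mem_sup.1
    (hN.sup_eq_top ▸ Submodule.mem_top : (1 : R) ∈ LinearMap.ker (LinearMap.mulLeft k (f ^ N)) ⊔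
      LinearMap.range (LinearMap.mulLeft k (f ^ N)))
  have ha : f ^ N * a = 0 := ha
  have hc : f ^ N * c = b := hc
  obtain rfl : b = 1 - a := eq_sub_of_add_eq' hab
  have haa : a * a = a := by
    have := key (a * a - a) ((1 - a) * a) (by rw [mul_sub, ← mul_assoc, ha, zero_mul, sub_zero])
      ⟨c * a, by rw [← mul_assoc, hc]⟩ (by noncomm_ring)
    exact sub_eq_zero.1 this.1
  have hfa : f * a = a * f := by
    have := key (f * a - a * f) (f * (1 - a) - (1 - a) * f)
      (by rw [mul_sub, ← mul_assoc, ← mul_assoc, ← pow_succ, pow_succ', mul_assoc, ha]; simp)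
      ⟨f * c - c * f, by
        rw [mul_sub, ← mul_assoc, ← mul_assoc, ← pow_succ, pow_succ', mul_assoc, hc]⟩
      (by noncomm_ring)
    exact sub_eq_zero.1 this.1
  obtain ⟨M, rfl⟩ : ∃ M, N = M + 1 := ⟨N - 1, by omega⟩
  have hbb : (1 - a) * (1 - a) = 1 - a := by
    rw [mul_sub, sub_mul, sub_mul, haa]; simp
  have hfb : f * (1 - a) = (1 - a) * f := by rw [mul_sub, sub_mul, hfa]; simp
  have hfg : f * ((1 - a) * (f ^ M * c) * (1 - a)) = 1 - a := by
    rw [← mul_assoc, ← mul_assoc, hfb, mul_assoc (1 - a) f, ← mul_assoc f, ← pow_succ', hc, hbb,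
      hbb]
  refine ⟨a, (1 - a) * (f ^ M * c) * (1 - a), M + 1, haa, hfa, ha, ?_, ?_, hfg, ?_⟩
  · rw [← mul_assoc, ← mul_assoc, hbb]
  · rw [mul_assoc, hbb]
  · set g := (1 - a) * (f ^ M * c) * (1 - a) with hg
    have hbg : (1 - a) * g = g := by rw [hg, ← mul_assoc, ← mul_assoc, hbb]
    have hgb : g * (1 - a) = g := by rw [hg, mul_assoc, hbb]
    -- The defect of the left inverse is killed by `f` yet lies in the range of the power, so it is
    -- zero.
    have h1 : f * (1 - a - g * f) = 0 := by
      rw [mul_sub, ← mul_assoc, hfg, hfb, sub_self]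
    have h2 : (1 - a) * (1 - a - g * f) = 1 - a - g * f := by
      rw [mul_sub, hbb, ← mul_assoc, hbg]
    have := key (1 - a - g * f) (-(1 - a - g * f)) (by rw [pow_succ, mul_assoc, h1, mul_zero])
      ⟨-(c * (1 - a - g * f)), by rw [mul_neg, ← mul_assoc, hc, h2]⟩ (by simp)
    exact (sub_eq_zero.1 this.1).symm

variable {A : Type w} [Category.{v} A] [Preadditive A] [HasBinaryBiproducts A]

/-- An object with a splitting of complementary idempotents is their biproduct. -/
def isoBiprodOfSplitting {X X₀ X₁ : A} (i₀ : X₀ ⟶ X) (p₀ : X ⟶ X₀) (i₁ : X₁ ⟶ X) (p₁ : X ⟶ X₁)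
    (h₀ : i₀ ≫ p₀ = 𝟙 X₀) (h₁ : i₁ ≫ p₁ = 𝟙 X₁) (h : p₀ ≫ i₀ + p₁ ≫ i₁ = 𝟙 X) :
    X ≅ X₀ ⊞ X₁ where
  hom := biprod.lift p₀ p₁
  inv := biprod.desc i₀ i₁
  hom_inv_id := by rw [biprod.lift_desc, h]
  inv_hom_id := by
    have h01 : i₀ ≫ p₁ = 0 := by
      have := congrArg (fun s => i₀ ≫ s ≫ p₁) h
      simp only [Preadditive.add_comp, Preadditive.comp_add, Category.assoc, h₁,
        Category.comp_id, Category.id_comp] at this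
      rw [← Category.assoc, h₀, Category.id_comp] at this
      simpa using this
    have h10 : i₁ ≫ p₀ = 0 := by
      have := congrArg (fun s => i₁ ≫ s ≫ p₀) h
      simp only [Preadditive.add_comp, Preadditive.comp_add, Category.assoc, h₀,
        Category.comp_id, Category.id_comp] at this
      rw [← Category.assoc i₁ p₁, h₁, Category.id_comp] at this
      simpa using this
    ext <;> simp [h₀, h₁, h01, h10]

variable (A) in
/-- Every endomorphism splits as the sum of a nilpotent one and an isomorphism. -/
def HasFitting : Prop :=
  ∀ (X : A) (f : X ⟶ X), ∃ (X₀ X₁ : A) (i₀ : X₀ ⟶ X) (p₀ : X ⟶ X₀) (i₁ : X₁ ⟶ X) (p₁ : X ⟶ X₁)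
    (f₀ : X₀ ⟶ X₀) (f₁ : X₁ ⟶ X₁) (N : ℕ), i₀ ≫ p₀ = 𝟙 X₀ ∧ i₁ ≫ p₁ = 𝟙 X₁ ∧
      p₀ ≫ i₀ + p₁ ≫ i₁ = 𝟙 X ∧ i₀ ≫ f = f₀ ≫ i₀ ∧ i₁ ≫ f = f₁ ≫ i₁ ∧
      f ≫ p₀ = p₀ ≫ f₀ ∧ f ≫ p₁ = p₁ ≫ f₁ ∧
      End.of f₀ ^ N = 0 ∧ IsIso f₁

omit [HasBinaryBiproducts A] in
-- The Fitting idempotent `a` of `End X` commutes with `f`; splitting `a` and `1 - a` gives two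
-- summands that `f` preserves, nilpotently on the first and invertibly on the second.
theorem hasFitting (k : Type*) [Field k] [Linear k A] [IsIdempotentComplete A]
    [∀ X : A, Module.Finite k (X ⟶ X)] : HasFitting A := by
  intro X f
  have : Module.Finite k (End X) := inferInstanceAs (Module.Finite k (X ⟶ X))
  -- Multiplication in `End X` reverses composition, so the left and right identities change places.
  obtain ⟨a, g, N, haa, hfa, hN, hgb, hbg, hgf, hfg⟩ : ∃ (a g : X ⟶ X) (N : ℕ), a ≫ a = a ∧
      f ≫ a = a ≫ f ∧ a ≫ (End.of f ^ N).asHom = 0 ∧ g ≫ (𝟙 X - a) = g ∧ (𝟙 X - a) ≫ g = g ∧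
      g ≫ f = 𝟙 X - a ∧ f ≫ g = 𝟙 X - a := by
    obtain ⟨a, g, N, haa, hfa, hN, hbg, hgb, hfg, hgf⟩ := exists_fitting_idempotent k (End.of f)
    exact ⟨a, g, N, haa, hfa.symm, hN, hbg, hgb, hfg, hgf⟩
  obtain ⟨X₀, i₀, p₀, h₀, h₀'⟩ := IsIdempotentComplete.idempotents_split X a haa
  obtain ⟨X₁, i₁, p₁, h₁, h₁'⟩ := IsIdempotentComplete.idempotents_split X (𝟙 X - a)
    (Idempotents.idem_of_id_sub_idem a haa)
  have e1 : i₀ ≫ a = i₀ := by rw [← h₀', ← Category.assoc, h₀, Category.id_comp]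
  have e2 : a ≫ p₀ = p₀ := by rw [← h₀', Category.assoc, h₀, Category.comp_id]
  have e3 : i₁ ≫ (𝟙 X - a) = i₁ := by rw [← h₁', ← Category.assoc, h₁, Category.id_comp]
  have e4 : (𝟙 X - a) ≫ p₁ = p₁ := by rw [← h₁', Category.assoc, h₁, Category.comp_id]
  have hfb : f ≫ (𝟙 X - a) = (𝟙 X - a) ≫ f := by
    rw [Preadditive.comp_sub, Preadditive.sub_comp, hfa]; simp
  have hi₀ : i₀ ≫ f = (i₀ ≫ f ≫ p₀) ≫ i₀ := by
    rw [Category.assoc, Category.assoc, h₀', hfa, ← Category.assoc, e1]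
  have hp₀ : f ≫ p₀ = p₀ ≫ (i₀ ≫ f ≫ p₀) := by
    rw [← Category.assoc, h₀', ← Category.assoc, ← hfa, Category.assoc, e2]
  have hi₁ : i₁ ≫ f = (i₁ ≫ f ≫ p₁) ≫ i₁ := by
    rw [Category.assoc, Category.assoc, h₁', hfb, ← Category.assoc, e3]
  have hp₁ : f ≫ p₁ = p₁ ≫ (i₁ ≫ f ≫ p₁) := by
    rw [← Category.assoc, h₁', ← Category.assoc, ← hfb, Category.assoc, e4]
  refine ⟨X₀, X₁, i₀, p₀, i₁, p₁, i₀ ≫ f ≫ p₀, i₁ ≫ f ≫ p₁, N, h₀, h₁, by rw [h₀', h₁']; simp,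
    hi₀, hi₁, hp₀, hp₁, ?_, ?_⟩
  · have hpow : ∀ n : ℕ, (End.of (i₀ ≫ f ≫ p₀) ^ n).asHom ≫ i₀ =
        i₀ ≫ (End.of f ^ n).asHom := by
      intro n
      induction n with
      | zero => exact (Category.id_comp i₀).trans (Category.comp_id i₀).symm
      | succ n ih =>
        rw [pow_succ, pow_succ]
        change ((i₀ ≫ f ≫ p₀) ≫ (End.of (i₀ ≫ f ≫ p₀) ^ n).asHom) ≫ i₀ =
          i₀ ≫ f ≫ (End.of f ^ n).asHom
        rw [Category.assoc, ih, ← Category.assoc, ← hi₀, Category.assoc]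
    have h6 : (End.of (i₀ ≫ f ≫ p₀) ^ N).asHom ≫ i₀ = 0 := by
      rw [hpow N, ← e1, Category.assoc, hN, comp_zero]
    have h7 := congrArg (· ≫ p₀) h6
    simp only [Category.assoc, h₀, Category.comp_id, zero_comp] at h7
    exact h7
  · refine ⟨i₁ ≫ g ≫ p₁, ?_, ?_⟩
    · rw [← Category.assoc, ← Category.assoc, ← hi₁]
      simp only [Category.assoc]
      rw [← Category.assoc f, hfg, e4, h₁]
    · simp only [Category.assoc]
      rw [← hp₁, ← Category.assoc g, hgf, e4, h₁]

end Fitting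

/-! ### The image of an additive functor -/

section Image

open scoped ZeroObject

variable {A : Type w} [Category.{v} A] {P : Type*} [Category* P] (ρ : A ⥤ P)

/-- The category with the objects of `A` and with the morphisms of `P` in the image of `ρ`. -/
abbrev ImageCat : Type w := Quotient ρ.homRel

/-- The projection to the image. -/
abbrev toImage : A ⥤ ImageCat ρ := Quotient.functor ρ.homRel

variable {ρ} in
theorem toImage_map_eq_iff {X Y : A} {f g : X ⟶ Y} :
    (toImage ρ).map f = (toImage ρ).map g ↔ ρ.map f = ρ.map g :=
  Quotient.functor_map_eq_iff ρ.homRel f g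

variable [Preadditive A] [Preadditive P] [ρ.Additive]

instance : Preadditive (ImageCat ρ) :=
  Quotient.preadditive ρ.homRel fun _ _ f₁ f₂ g₁ g₂ (h₁ : ρ.map f₁ = ρ.map f₂)
    (h₂ : ρ.map g₁ = ρ.map g₂) => show ρ.map _ = ρ.map _ by rw [ρ.map_add, ρ.map_add, h₁, h₂]

instance : (toImage ρ).Additive := ⟨rfl⟩

instance [HasBinaryBiproducts A] : HasBinaryBiproducts (ImageCat ρ) :=
  ⟨fun X Y => by
    have := preservesBinaryBiproducts_of_preservesBiproducts (toImage ρ)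
    exact inferInstanceAs (HasBinaryBiproduct ((toImage ρ).obj X.as) ((toImage ρ).obj Y.as))⟩

instance [HasZeroObject A] : HasZeroObject (ImageCat ρ) :=
  ⟨(toImage ρ).obj 0, (toImage ρ).map_isZero (isZero_zero A)⟩

variable {ρ} in
theorem isZero_toImage {X : A} (h : IsZero (ρ.obj X)) : IsZero ((toImage ρ).obj X) := by
  rw [IsZero.iff_id_eq_zero, ← (toImage ρ).map_id, ← (toImage ρ).map_zero, toImage_map_eq_iff]
  exact h.eq_of_src _ _

variable [HasZeroObject A] [HasBinaryBiproducts A] [HasZeroObject P] [HasBinaryBiproducts P]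

omit [HasZeroObject A] in
theorem IsoClass.mk_of_splitting {X X₀ X₁ : A} {i₀ : X₀ ⟶ X} {p₀ : X ⟶ X₀} {i₁ : X₁ ⟶ X}
    {p₁ : X ⟶ X₁} (h₀ : i₀ ≫ p₀ = 𝟙 X₀) (h₁ : i₁ ≫ p₁ = 𝟙 X₁) (h : p₀ ≫ i₀ + p₁ ≫ i₁ = 𝟙 X) :
    IsoClass.mk X = IsoClass.mk X₀ + IsoClass.mk X₁ :=
  IsoClass.mk_eq_mk_iff.2 ⟨isoBiprodOfSplitting i₀ p₀ i₁ p₁ h₀ h₁ h⟩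

/-- Induction on the length of `ρ X`. If the image of `X` is nonzero and not local, some
endomorphism `a` has neither `a` nor `1 - a` invertible. Its lift to `A` has a Fitting splitting,
and neither summand can be killed by `ρ`, so both are shorter. The splitting is made in `A`, so no
idempotents need to split in the image. -/
theorem isKrullSchmidt_imageCat (hA : HasFitting A) (ℓ : IsoClass P →+ ℕ)
    (hℓ : ∀ X : P, ℓ (IsoClass.mk X) = 0 → IsZero X) : IsKrullSchmidt (ImageCat ρ) := by
  suffices H : ∀ (n : ℕ) (X : A), ℓ (IsoClass.mk (ρ.obj X)) = n →
      ∃ s : Multiset (IsoClass (ImageCat ρ)), (∀ a ∈ s, IsoClass.IsLocal a) ∧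
        s.sum = IsoClass.mk ((toImage ρ).obj X) from
    IsoClass.ind fun X => H _ X.as rfl
  intro n
  induction n using Nat.strong_induction_on with
  | _ n ih =>
  intro X hX
  by_cases hz : IsZero ((toImage ρ).obj X)
  · exact ⟨0, by simp, (IsoClass.mk_eq_zero hz).symm⟩
  by_cases hl : IsLocalRing (End ((toImage ρ).obj X))
  · exact ⟨{IsoClass.mk ((toImage ρ).obj X)}, fun a ha => ⟨_, (Multiset.mem_singleton.1 ha).symm, hl⟩,
      by simp⟩
  have : Nontrivial (End ((toImage ρ).obj X)) :=
    ⟨𝟙 _, 0, fun h => hz ((IsZero.iff_id_eq_zero _).2 h)⟩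
  obtain ⟨a, ha⟩ := not_forall.1 (mt IsLocalRing.of_isUnit_or_isUnit_one_sub_self hl)
  obtain ⟨ha1, ha2⟩ := not_or.1 ha
  obtain ⟨f, rfl⟩ := (toImage ρ).map_surjective a
  obtain ⟨X₀, X₁, i₀, p₀, i₁, p₁, f₀, f₁, N, h₀, h₁, h, hi₀, hi₁, hp₀, hp₁, hN, hf₁⟩ := hA X f
  have hQ : IsoClass.mk ((toImage ρ).obj X) = IsoClass.mk ((toImage ρ).obj X₀) +
      IsoClass.mk ((toImage ρ).obj X₁) := by
    rw [← IsoClass.map_mk, IsoClass.mk_of_splitting h₀ h₁ h, map_add]; rfl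
  have hP : IsoClass.mk (ρ.obj X) = IsoClass.mk (ρ.obj X₀) + IsoClass.mk (ρ.obj X₁) := by
    rw [← IsoClass.map_mk, IsoClass.mk_of_splitting h₀ h₁ h, map_add]; rfl
  rw [hP, map_add] at hX
  -- If the nilpotent summand disappeared, `f` would become invertible in the image.
  have hX₀ : ℓ (IsoClass.mk (ρ.obj X₀)) ≠ 0 := by
    intro h0
    have hz₀ := isZero_toImage (hℓ _ h0)
    have hid : (toImage ρ).map p₁ ≫ (toImage ρ).map i₁ = 𝟙 _ := by
      rw [← (toImage ρ).map_comp, ← (toImage ρ).map_id, ← h, (toImage ρ).map_add,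
        (toImage ρ).map_comp p₀, hz₀.eq_of_src ((toImage ρ).map i₀) 0, comp_zero, zero_add]
    refine ha1 ((isUnit_iff_isIso _).2 ⟨(toImage ρ).map (p₁ ≫ inv f₁ ≫ i₁), ?_, ?_⟩)
    · rw [← (toImage ρ).map_comp, ← Category.assoc, hp₁, Category.assoc, IsIso.hom_inv_id_assoc,
        (toImage ρ).map_comp, hid]
    · rw [← (toImage ρ).map_comp, Category.assoc, Category.assoc, hi₁, IsIso.inv_hom_id_assoc,
        (toImage ρ).map_comp, hid]
  -- If the invertible summand disappeared, `f` would become nilpotent and `1 - f` a unit.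
  have hX₁ : ℓ (IsoClass.mk (ρ.obj X₁)) ≠ 0 := by
    intro h0
    have hz₁ := isZero_toImage (hℓ _ h0)
    have hpow : ∀ n : ℕ, i₀ ≫ (End.of f ^ n).asHom = (End.of f₀ ^ n).asHom ≫ i₀ := by
      intro n
      induction n with
      | zero => exact (Category.comp_id i₀).trans (Category.id_comp i₀).symm
      | succ n ih =>
        rw [pow_succ, pow_succ]
        change i₀ ≫ f ≫ (End.of f ^ n).asHom = (f₀ ≫ (End.of f₀ ^ n).asHom) ≫ i₀
        rw [← Category.assoc, hi₀, Category.assoc, ih, Category.assoc]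
    have hmap : ∀ n : ℕ, (toImage ρ).map (End.of f ^ n).asHom =
        (End.of ((toImage ρ).map f) ^ n).asHom := by
      intro n
      induction n with
      | zero => exact (toImage ρ).map_id X
      | succ n ih =>
        rw [pow_succ, pow_succ]
        change (toImage ρ).map (f ≫ (End.of f ^ n).asHom) =
          (toImage ρ).map f ≫ (End.of ((toImage ρ).map f) ^ n).asHom
        rw [(toImage ρ).map_comp, ih]
    have hnil : (toImage ρ).map (End.of f ^ N).asHom = 0 := by
      rw [← Category.id_comp (End.of f ^ N).asHom, ← h, Preadditive.add_comp,
        (toImage ρ).map_add, Category.assoc, Category.assoc, (toImage ρ).map_comp p₁,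
        hz₁.eq_of_tgt ((toImage ρ).map p₁) 0, zero_comp, add_zero, hpow, hN]
      change (toImage ρ).map (p₀ ≫ (0 : X₀ ⟶ X₀) ≫ i₀) = 0
      rw [zero_comp, comp_zero, (toImage ρ).map_zero]
    refine ha2 (IsNilpotent.isUnit_one_sub ⟨N, ?_⟩)
    rw [hmap] at hnil
    exact hnil
  obtain ⟨s₀, hs₀, hs₀'⟩ := ih _ (by omega) X₀ rfl
  obtain ⟨s₁, hs₁, hs₁'⟩ := ih _ (by omega) X₁ rfl
  refine ⟨s₀ + s₁, fun a ha => (Multiset.mem_add.1 ha).elim (hs₀ a) (hs₁ a), ?_⟩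
  rw [Multiset.sum_add, hs₀', hs₁', hQ]

omit [HasZeroObject A] in
theorem exists_complement [IsIdempotentComplete A] {X Y : A} (i : X ⟶ Y) (p : Y ⟶ X)
    (h : i ≫ p = 𝟙 X) : ∃ Y' : A, IsoClass.mk Y = IsoClass.mk X + IsoClass.mk Y' := by
  have hidem : (p ≫ i) ≫ (p ≫ i) = p ≫ i := by
    rw [Category.assoc, ← Category.assoc i, h, Category.id_comp]
  obtain ⟨Y', j, q, hj, hq⟩ := IsIdempotentComplete.idempotents_split Y (𝟙 Y - p ≫ i)
    (Idempotents.idem_of_id_sub_idem _ hidem)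
  exact ⟨Y', IsoClass.mk_of_splitting h hj (by rw [hq]; simp)⟩

theorem SplitGr.exists_eq_sub (z : SplitGr A) : ∃ M N : A,
    z = Algebra.GrothendieckAddGroup.of (IsoClass.mk M) -
      Algebra.GrothendieckAddGroup.of (IsoClass.mk N) := by
  induction z using AddLocalization.ind with | _ z
  obtain ⟨a, b, hb⟩ := z
  obtain ⟨M, rfl⟩ := IsoClass.exists_rep a
  obtain ⟨N, rfl⟩ := IsoClass.exists_rep b
  refine ⟨M, N, ?_⟩
  rw [eq_sub_iff_add_eq, AddLocalization.mk_eq_addMonoidOf_mk']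
  exact AddSubmonoid.LocalizationMap.mk'_spec _ _ ⟨_, hb⟩

theorem SplitGr.of_eq_of_iff {a b : IsoClass A} :
    (Algebra.GrothendieckAddGroup.of a : SplitGr A) = Algebra.GrothendieckAddGroup.of b ↔
      ∃ c, a + c = b + c := by
  refine ((AddLocalization.addMonoidOf ⊤).eq_iff_exists).trans
    ⟨fun ⟨c, hc⟩ => ⟨c.1, ?_⟩, fun ⟨c, hc⟩ => ⟨⟨c, AddSubmonoid.mem_top c⟩, ?_⟩⟩
  · rw [add_comm a, add_comm b]; exact hc
  · rw [add_comm, hc, add_comm]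

theorem SplitGr.map_surjective_of_obj {B : Type*} [Category* B] [Preadditive B] [HasZeroObject B]
    [HasBinaryBiproducts B] (F : A ⥤ B) [F.Additive] (hF : ∀ Y : B, ∃ X : A, F.obj X = Y) :
    Function.Surjective (SplitGr.map F) := by
  intro z
  obtain ⟨M, N, rfl⟩ := SplitGr.exists_eq_sub z
  obtain ⟨M, rfl⟩ := hF M
  obtain ⟨N, rfl⟩ := hF N
  exact ⟨Algebra.GrothendieckAddGroup.of (IsoClass.mk M) -
      Algebra.GrothendieckAddGroup.of (IsoClass.mk N), by rw [map_sub, SplitGr.map_of, SplitGr.map_of]⟩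

/-- The elements of the Grothendieck group that vanish in the image of `ρ` are the differences of
objects that are killed by `ρ`. -/
theorem SplitGr.exists_of_map_toImage_eq_zero (hA : HasFitting A) [IsIdempotentComplete A]
    (ℓ : IsoClass P →+ ℕ) (hℓ : ∀ X : P, ℓ (IsoClass.mk X) = 0 → IsZero X) (z : SplitGr A)
    (hz : SplitGr.map (toImage ρ) z = 0) : ∃ M N : A, IsZero (ρ.obj M) ∧ IsZero (ρ.obj N) ∧
      z = Algebra.GrothendieckAddGroup.of (IsoClass.mk M) -
        Algebra.GrothendieckAddGroup.of (IsoClass.mk N) := by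
  obtain ⟨M, N, hMN, rfl⟩ : ∃ M N : A, Nonempty ((toImage ρ).obj M ≅ (toImage ρ).obj N) ∧
      z = Algebra.GrothendieckAddGroup.of (IsoClass.mk M) -
        Algebra.GrothendieckAddGroup.of (IsoClass.mk N) := by
    obtain ⟨M, N, rfl⟩ := SplitGr.exists_eq_sub z
    rw [map_sub, SplitGr.map_of, SplitGr.map_of, sub_eq_zero, SplitGr.of_eq_of_iff] at hz
    obtain ⟨c, hc⟩ := hz
    obtain ⟨C, rfl⟩ := IsoClass.exists_rep c
    -- Equality in the group completion is isomorphism after adding some `C`, and `C` comes from an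
    -- object of `A`.
    refine ⟨M ⊞ C.as, N ⊞ C.as, ?_, ?_⟩
    · rw [← IsoClass.mk_eq_mk_iff, ← IsoClass.map_mk, ← IsoClass.map_mk, IsoClass.mk_biprod,
        IsoClass.mk_biprod, map_add, map_add]
      exact hc
    · rw [IsoClass.mk_biprod, IsoClass.mk_biprod, map_add, map_add]; abel
  obtain ⟨φ⟩ := hMN
  obtain ⟨f, hf⟩ := (toImage ρ).map_surjective φ.hom
  obtain ⟨g, hg⟩ := (toImage ρ).map_surjective φ.inv
  have hfg : ρ.map (f ≫ g) = 𝟙 _ := by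
    rw [← ρ.map_id, ← toImage_map_eq_iff, (toImage ρ).map_comp, hf, hg, (toImage ρ).map_id]
    exact φ.hom_inv_id
  have hgf : ρ.map (g ≫ f) = 𝟙 _ := by
    rw [← ρ.map_id, ← toImage_map_eq_iff, (toImage ρ).map_comp, hf, hg, (toImage ρ).map_id]
    exact φ.inv_hom_id
  -- The composite `f ≫ g` is sent to the identity by `ρ`. On `M₁` it is invertible, so `M₁` is a
  -- common summand of `M` and `N`. On `M₀` it is nilpotent as well as the identity under `ρ`, so `ρ
  -- M₀ = 0`. Comparing lengths then shows that `ρ` kills the complement `N'` too.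
  obtain ⟨M₀, M₁, i₀, p₀, i₁, p₁, f₀, f₁, n, h₀, h₁, h, hi₀, hi₁, hp₀, hp₁, hn, hf₁⟩ := hA M (f ≫ g)
  have hM := IsoClass.mk_of_splitting h₀ h₁ h
  obtain ⟨N', hN⟩ := exists_complement (i₁ ≫ f) (g ≫ p₁ ≫ inv f₁) (by
    have : (i₁ ≫ f) ≫ g ≫ p₁ ≫ inv f₁ = (i₁ ≫ f ≫ g) ≫ p₁ ≫ inv f₁ := by
      simp only [Category.assoc]
    rw [this, hi₁, Category.assoc, ← Category.assoc i₁, h₁, Category.id_comp, IsIso.hom_inv_id])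
  have hM₀ : IsZero (ρ.obj M₀) := by
    have h1 : ρ.map f₀ = 𝟙 _ := by
      have h2 : f₀ = i₀ ≫ (f ≫ g) ≫ p₀ := by
        rw [← Category.assoc, hi₀, Category.assoc, h₀, Category.comp_id]
      rw [h2, ρ.map_comp, ρ.map_comp, hfg, Category.id_comp, ← ρ.map_comp, h₀, ρ.map_id]
    have hmap : ∀ n : ℕ, ρ.map (End.of f₀ ^ n).asHom = 𝟙 _ := by
      intro n
      induction n with
      | zero => exact ρ.map_id _
      | succ n ih =>
        rw [pow_succ]
        change ρ.map (f₀ ≫ (End.of f₀ ^ n).asHom) = _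
        rw [ρ.map_comp, ih, h1, Category.comp_id]
    rw [IsZero.iff_id_eq_zero, ← hmap n, hn]
    exact ρ.map_zero _ _
  have hℓM : ℓ (IsoClass.mk (ρ.obj M)) = ℓ (IsoClass.mk (ρ.obj M₁)) := by
    rw [← IsoClass.map_mk, hM, map_add, map_add, IsoClass.map_mk, IsoClass.map_mk,
      IsoClass.mk_eq_zero hM₀, map_zero, zero_add]
  have hℓN : ℓ (IsoClass.mk (ρ.obj N)) = ℓ (IsoClass.mk (ρ.obj M₁)) +
      ℓ (IsoClass.mk (ρ.obj N')) := by
    rw [← IsoClass.map_mk, hN, map_add, map_add, IsoClass.map_mk, IsoClass.map_mk]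
  have hℓMN : IsoClass.mk (ρ.obj M) = IsoClass.mk (ρ.obj N) :=
    IsoClass.mk_eq_mk_iff.2 ⟨⟨ρ.map f, ρ.map g, by rw [← ρ.map_comp, hfg],
      by rw [← ρ.map_comp, hgf]⟩⟩
  refine ⟨M₀, N', hM₀, hℓ _ ?_, ?_⟩
  · rw [hℓMN] at hℓM; omega
  · rw [hM, hN, map_add, map_add]; abel

end Image

/-! ### Alternating sums of cofaces that permute a basis -/

section BasisCofaces

variable {G : ℕ → Type*} [∀ m, AddCommGroup (G m)]

/-- The alternating sum of the cofaces. -/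
def altSum (D : ∀ m, Fin (m + 2) → G m →+ G (m + 1)) (m : ℕ) : G m →+ G (m + 1) :=
  ∑ i : Fin (m + 2), (-1 : ℤ) ^ (i : ℕ) • D m i

theorem altSum_apply (D : ∀ m, Fin (m + 2) → G m →+ G (m + 1)) (m : ℕ) (a : G m) :
    altSum D m a = ∑ i : Fin (m + 2), (-1 : ℤ) ^ (i : ℕ) • D m i a := by
  simp [altSum, AddMonoidHom.finsetSum_apply]

variable {I : ℕ → Type*} (b : ∀ m, Module.Basis (I m) ℤ (G m))
  {D : ∀ m, Fin (m + 2) → G m →+ G (m + 1)} {δ : ∀ m, Fin (m + 2) → I m → I (m + 1)}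

open Classical in
/-- The extra codegeneracy: it removes a coface `δ 0`, and kills the basis elements that are not in
the image of `δ 0`. -/
def removeCoface (δ : ∀ m, Fin (m + 2) → I m → I (m + 1)) (m : ℕ) : G (m + 1) →ₗ[ℤ] G m :=
  (b (m + 1)).constr ℤ fun x => if h : ∃ z, δ m 0 z = x then b m h.choose else 0

theorem removeCoface_of_mem (hinj : ∀ m, Function.Injective (δ m 0)) (m : ℕ) (z : I m) :
    removeCoface b δ m (b (m + 1) (δ m 0 z)) = b m z := by
  have h : ∃ z', δ m 0 z' = δ m 0 z := ⟨z, rfl⟩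
  rw [removeCoface, Module.Basis.constr_basis, dif_pos h, hinj m h.choose_spec]

theorem removeCoface_of_notMem (m : ℕ) (x : I (m + 1)) (h : ¬ ∃ z, δ m 0 z = x) :
    removeCoface b δ m (b (m + 1) x) = 0 := by
  rw [removeCoface, Module.Basis.constr_basis, dif_neg h]

variable (hD : ∀ m i x, D m i (b m x) = b (m + 1) (δ m i x))
  (hinj : ∀ m, Function.Injective (δ m 0))

include hD hinj

/-- With `h` the removal of `δ 0`, the identity is `d h + h d = 1`, checked on basis elements. For
`x = δ 0 z` one has `d h x = d z`, and `hcomm` gives `h d x = x - d z`. For any other `x`, `h x =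
0`, and `hpull` makes `h` kill every term of `d x` except `δ 0 x`. -/
theorem exact_of_basis
    (hcomm : ∀ m (j : Fin (m + 2)) (x : I m),
      δ (m + 1) j.succ (δ m 0 x) = δ (m + 1) 0 (δ m j x))
    (hpull : ∀ m (j : Fin (m + 2)) (x y : I (m + 1)),
      δ (m + 1) j.succ x = δ (m + 1) 0 y → ∃ z, δ m 0 z = x)
    (m : ℕ) (a : G (m + 1)) (ha : altSum D (m + 1) a = 0) : ∃ c : G m, altSum D m c = a := by
  have key : (altSum D m).toIntLinearMap ∘ₗ removeCoface b δ m +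
      removeCoface b δ (m + 1) ∘ₗ (altSum D (m + 1)).toIntLinearMap = LinearMap.id := by
    refine (b (m + 1)).ext fun x => ?_
    simp only [LinearMap.add_apply, LinearMap.comp_apply, AddMonoidHom.coe_toIntLinearMap,
      LinearMap.id_apply, altSum_apply, hD, map_sum, map_zsmul]
    rw [Fin.sum_univ_succ (n := m + 2)]
    by_cases hx : ∃ z, δ m 0 z = x
    · obtain ⟨z, rfl⟩ := hx
      simp only [removeCoface_of_mem b hinj, hcomm, hD, Fin.val_zero, pow_zero, one_smul,
        Fin.val_succ, pow_succ, mul_neg_one, neg_smul, Finset.sum_neg_distrib]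
      abel
    · have h0 : ∀ j : Fin (m + 2), removeCoface b δ (m + 1) (b (m + 2) (δ (m + 1) j.succ x)) = 0 :=
        fun j => removeCoface_of_notMem b _ _ fun ⟨y, hy⟩ => hx (hpull m j x y hy.symm)
      simp only [removeCoface_of_notMem b _ _ hx, removeCoface_of_mem b hinj, h0, map_zero,
        smul_zero, Finset.sum_const_zero, Fin.val_zero, pow_zero, one_smul, zero_add, add_zero]
  refine ⟨removeCoface b δ m a, ?_⟩
  have := LinearMap.congr_fun key a
  simpa [ha] using this

/-- For a basis element `x`, the difference `x - h d x` is `h (δ 1 x)`. This is `x` itself when the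
two cofaces of `x` agree and zero otherwise. A cocycle equals its own difference. -/
theorem mem_span_of_basis (hpull : ∀ x y : I 0, δ 0 1 x = δ 0 0 y → x = y)
    (a : G 0) (ha : altSum D 0 a = 0) :
    a ∈ AddSubgroup.closure {c | ∃ x : I 0, δ 0 0 x = δ 0 1 x ∧ c = b 0 x} := by
  classical
  let S := AddSubgroup.closure {c | ∃ x : I 0, δ 0 0 x = δ 0 1 x ∧ c = b 0 x}
  have key : ∀ c, c - removeCoface b δ 0 (altSum D 0 c) ∈ S := by
    intro c
    induction (b 0).mem_span c using Submodule.span_induction with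
    | mem c hc =>
      obtain ⟨x, rfl⟩ := hc
      rw [altSum_apply, Fin.sum_univ_two, hD, hD, map_add, map_zsmul, map_zsmul]
      simp only [Fin.val_zero, Fin.val_one, pow_zero, pow_one, one_smul, neg_smul]
      rw [removeCoface_of_mem b hinj]
      by_cases hx : ∃ y, δ 0 0 y = δ 0 1 x
      · obtain ⟨y, hy⟩ := hx
        obtain rfl := hpull x y hy.symm
        rw [← hy, removeCoface_of_mem b hinj]
        simpa using (AddSubgroup.subset_closure ⟨x, hy, rfl⟩ : b 0 x ∈ S)
      · rw [removeCoface_of_notMem b _ _ hx]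
        simp [S.zero_mem]
    | zero => simp [S.zero_mem]
    | add c d _ _ hc hd =>
      rw [map_add, map_add, add_sub_add_comm]
      exact S.add_mem hc hd
    | smul n c _ hc =>
      rw [map_zsmul, map_zsmul, ← smul_sub]
      exact S.zsmul_mem hc n
  simpa [ha] using key a

end BasisCofaces

/-! ### Local objects and fully faithful functors -/

section LocalObjects

theorem isLocalRing_of_ringEquiv {R S : Type*} [Ring R] [Ring S] (e : R ≃+* S) [IsLocalRing R] :
    IsLocalRing S := by
  have : Nontrivial S := e.injective.nontrivial
  refine ⟨fun {a b} h => ?_⟩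
  have h' : e.symm a + e.symm b = 1 := by rw [← map_add, h, map_one]
  refine (IsLocalRing.isUnit_or_isUnit_of_add_one h').imp (fun h => ?_) fun h => ?_
  · simpa using h.map e
  · simpa using h.map e

theorem isLocalRing_end_of_iso {B : Type*} [Category* B] [Preadditive B] {X Y : B} (e : X ≅ Y)
    [IsLocalRing (End X)] : IsLocalRing (End Y) := by
  let φ : End X ≃+* End Y :=
    { e.conj with
      map_add' := fun f g => by
        change e.inv ≫ (f.asHom + g.asHom) ≫ e.hom = e.inv ≫ f.asHom ≫ e.hom + e.inv ≫ g.asHom ≫ e.hom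
        simp }
  exact isLocalRing_of_ringEquiv φ

theorem isLocalRing_end_obj_iff {B B' : Type*} [Category* B] [Category* B'] [Preadditive B]
    [Preadditive B'] (F : B ⥤ B') [F.Additive] [F.Full] [F.Faithful] (X : B) :
    IsLocalRing (End (F.obj X)) ↔ IsLocalRing (End X) := by
  let e : End X ≃+* End (F.obj X) :=
    { (Functor.FullyFaithful.ofFullyFaithful F).mulEquivEnd X with
      map_add' := fun f g => F.map_add (f := f) (g := g) }
  exact ⟨fun _ => isLocalRing_of_ringEquiv e.symm, fun _ => isLocalRing_of_ringEquiv e⟩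

theorem IsoClass.isLocal_mk_iff {B : Type*} [Category* B] [Preadditive B] (X : B) :
    IsoClass.IsLocal (IsoClass.mk X) ↔ IsLocalRing (End X) := by
  refine ⟨fun ⟨Y, hY, _⟩ => ?_, fun h => ⟨X, rfl, h⟩⟩
  obtain ⟨e⟩ := IsoClass.mk_eq_mk_iff.1 hY
  exact isLocalRing_end_of_iso e

theorem IsoClass.isLocal_map_iff {B B' : Type*} [Category* B] [Category* B'] [Preadditive B]
    [Preadditive B'] [HasZeroObject B] [HasZeroObject B'] [HasBinaryBiproducts B]
    [HasBinaryBiproducts B'] (F : B ⥤ B') [F.Additive] [F.Full] [F.Faithful] (c : IsoClass B) :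
    IsoClass.IsLocal (IsoClass.map F c) ↔ IsoClass.IsLocal c := by
  obtain ⟨X, rfl⟩ := IsoClass.exists_rep c
  rw [IsoClass.map_mk, IsoClass.isLocal_mk_iff, IsoClass.isLocal_mk_iff, isLocalRing_end_obj_iff]

/-- Up to the identification `F ⋙ G = 𝟭`, the preimage of `f` is `G f`; faithfulness of `G` detects
that this is right. -/
theorem full_of_comp_eq_id {B B' : Type*} [Category* B] [Category* B'] (F : B ⥤ B') (G : B' ⥤ B)
    [G.Faithful] (h : F ⋙ G = 𝟭 B) : F.Full where
  map_surjective {X Y} f := by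
    let η : F ⋙ G ≅ 𝟭 B := eqToIso h
    refine ⟨η.inv.app X ≫ G.map f ≫ η.hom.app Y, G.map_injective ?_⟩
    have := η.hom.naturality (η.inv.app X ≫ G.map f ≫ η.hom.app Y)
    rw [← cancel_mono (η.hom.app Y)]
    simpa using this

end LocalObjects

/-! ### Modules over a simplicial object, modulo the maps that vanish in dimension zero -/

section Simplicial

open Opposite Simplicial

variable (k : Type u) [Field k] (X : SimplicialObject Cat.{v, w})

/-- The modules in dimension `n`. -/
abbrev ModAt (n : SimplexCategory) : Type _ := CatMod k (X.obj (op n))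

/-- The functor on modules induced by a simplicial operator. -/
abbrev pull {n n' : SimplexCategory} (φ : n ⟶ n') : ModAt k X n ⥤ ModAt k X n' :=
  (Functor.whiskeringLeft _ _ (FGModuleCat.{u} k)).obj (X.map φ.op).toFunctor

theorem pull_id (n : SimplexCategory) : pull k X (𝟙 n) = 𝟭 _ := by
  rw [pull, op_id, X.map_id]; rfl

theorem pull_comp {n n' n'' : SimplexCategory} (φ : n ⟶ n') (ψ : n' ⟶ n'') :
    pull k X (φ ≫ ψ) = pull k X φ ⋙ pull k X ψ := by
  rw [pull, op_comp, X.map_comp]; rfl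

/-- Restriction to dimension zero, along the total degeneracy. -/
abbrev toZero (n : SimplexCategory) : ModAt k X n ⥤ ModAt k X ⦋0⦌ :=
  pull k X (SimplexCategory.isTerminalZero.from n)

/-- Dimension zero is terminal in the simplex category. Hence every operator respects the maps that
vanish there, and is faithful modulo them. -/
theorem pull_comp_toZero {n n' : SimplexCategory} (φ : n ⟶ n') :
    pull k X φ ⋙ toZero k X n' = toZero k X n := by
  rw [toZero, ← pull_comp, SimplexCategory.isTerminalZero.hom_ext
    (φ ≫ SimplexCategory.isTerminalZero.from n') (SimplexCategory.isTerminalZero.from n)]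

theorem toZero_map_pull_eq_iff {n n' : SimplexCategory} (φ : n ⟶ n') {M N : ModAt k X n}
    (f g : M ⟶ N) :
    (toZero k X n').map ((pull k X φ).map f) = (toZero k X n').map ((pull k X φ).map g) ↔
      (toZero k X n).map f = (toZero k X n).map g := by
  rw [← pull_comp_toZero k X φ]; rfl

/-- Modules in dimension `n`, modulo the maps that vanish in dimension zero. -/
abbrev RedMod (n : SimplexCategory) : Type _ := ImageCat (toZero k X n)

/-- The functor on reduced modules induced by a simplicial operator. -/
def redPull {n n' : SimplexCategory} (φ : n ⟶ n') : RedMod k X n ⥤ RedMod k X n' :=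
  CategoryTheory.Quotient.lift _ (pull k X φ ⋙ toImage (toZero k X n')) fun _ _ f g h =>
    toImage_map_eq_iff.2 ((toZero_map_pull_eq_iff k X φ f g).2 h)

theorem toImage_comp_redPull {n n' : SimplexCategory} (φ : n ⟶ n') :
    toImage (toZero k X n) ⋙ redPull k X φ = pull k X φ ⋙ toImage (toZero k X n') :=
  CategoryTheory.Quotient.lift_spec _ _ _

instance {n n' : SimplexCategory} (φ : n ⟶ n') : (redPull k X φ).Additive where
  map_add {M N f g} := by
    obtain ⟨f, rfl⟩ := (toImage (toZero k X n)).map_surjective f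
    obtain ⟨g, rfl⟩ := (toImage (toZero k X n)).map_surjective g
    exact ((pull k X φ) ⋙ toImage (toZero k X n')).map_add (f := f) (g := g)

instance {n n' : SimplexCategory} (φ : n ⟶ n') : (redPull k X φ).Faithful where
  map_injective {M N f g} h := by
    obtain ⟨f, rfl⟩ := (toImage (toZero k X n)).map_surjective f
    obtain ⟨g, rfl⟩ := (toImage (toZero k X n)).map_surjective g
    exact toImage_map_eq_iff.2 ((toZero_map_pull_eq_iff k X φ f g).1 (toImage_map_eq_iff.1 h))

theorem redPull_id (n : SimplexCategory) : redPull k X (𝟙 n) = 𝟭 _ := by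
  apply Quotient.lift_unique'
  rw [toImage_comp_redPull, pull_id]; rfl

theorem redPull_comp {n n' n'' : SimplexCategory} (φ : n ⟶ n') (ψ : n' ⟶ n'') :
    redPull k X (φ ≫ ψ) = redPull k X φ ⋙ redPull k X ψ := by
  apply Quotient.lift_unique'
  rw [toImage_comp_redPull, pull_comp, ← Functor.assoc, toImage_comp_redPull, Functor.assoc,
    Functor.assoc, toImage_comp_redPull]

/-- The retraction `σ` also induces a faithful functor, so a split operator is full. This is what
passing to reduced modules buys. -/
theorem full_redPull {n n' : SimplexCategory} (φ : n ⟶ n') (σ : n' ⟶ n) (h : φ ≫ σ = 𝟙 n) :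
    (redPull k X φ).Full :=
  full_of_comp_eq_id _ (redPull k X σ) (by rw [← redPull_comp, h, redPull_id])

theorem map_redPull_id (n : SimplexCategory) (c : IsoClass (RedMod k X n)) :
    IsoClass.map (redPull k X (𝟙 n)) c = c := by
  obtain ⟨M, rfl⟩ := IsoClass.exists_rep c
  rw [IsoClass.map_mk, redPull_id]; rfl

theorem map_redPull_map {n n' n'' : SimplexCategory} (φ : n ⟶ n') (ψ : n' ⟶ n'')
    (c : IsoClass (RedMod k X n)) :
    IsoClass.map (redPull k X ψ) (IsoClass.map (redPull k X φ) c) =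
      IsoClass.map (redPull k X (φ ≫ ψ)) c := by
  obtain ⟨M, rfl⟩ := IsoClass.exists_rep c
  rw [IsoClass.map_mk, IsoClass.map_mk, IsoClass.map_mk, redPull_comp]; rfl

theorem exists_retraction_coface {m : ℕ} (i : Fin (m + 2)) :
    ∃ σ : ⦋m + 1⦌ ⟶ ⦋m⦌, SimplexCategory.δ i ≫ σ = 𝟙 _ := by
  induction i using Fin.cases with
  | zero => exact ⟨SimplexCategory.σ 0, SimplexCategory.δ_comp_σ_self (i := 0)⟩
  | succ i => exact ⟨SimplexCategory.σ i, SimplexCategory.δ_comp_σ_succ⟩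

instance {m : ℕ} (i : Fin (m + 2)) : (redPull k X (SimplexCategory.δ i)).Full :=
  let ⟨σ, h⟩ := exists_retraction_coface i
  full_redPull k X _ σ h

/-- The cofaces on the classes of local reduced modules. -/
def localCoface (m : ℕ) (i : Fin (m + 2)) (c : LocalClass (RedMod k X ⦋m⦌)) :
    LocalClass (RedMod k X ⦋m + 1⦌) :=
  ⟨IsoClass.map (redPull k X (SimplexCategory.δ i)) c.1,
    (IsoClass.isLocal_map_iff _ _).2 c.2⟩

theorem localCoface_injective (m : ℕ) (i : Fin (m + 2)) :
    Function.Injective (localCoface k X m i) := by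
  obtain ⟨σ, h⟩ := exists_retraction_coface i
  intro c d hcd
  have := congrArg (fun x => IsoClass.map (redPull k X σ) x.1) hcd
  simp only [localCoface, map_redPull_map, h, map_redPull_id] at this
  exact Subtype.ext this

theorem localCoface_comm (m : ℕ) (j : Fin (m + 2)) (c : LocalClass (RedMod k X ⦋m⦌)) :
    localCoface k X (m + 1) j.succ (localCoface k X m 0 c) =
      localCoface k X (m + 1) 0 (localCoface k X m j c) := by
  apply Subtype.ext
  simp only [localCoface, map_redPull_map]
  rw [SimplexCategory.δ_comp_δ (Fin.zero_le j)]; rfl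

/-- Apply a codegeneracy that retracts `δ j.succ` and move it past `δ 0`: the result exhibits `x` as
`δ 0` of a codegeneracy of `y`. That class is local because `δ 0` reflects locality. -/
theorem exists_localCoface_eq (m : ℕ) (j : Fin (m + 2)) (x y : LocalClass (RedMod k X ⦋m + 1⦌))
    (h : localCoface k X (m + 1) j.succ x = localCoface k X (m + 1) 0 y) :
    ∃ z, localCoface k X m 0 z = x := by
  -- The retraction must have positive index: `σ 0` would cancel `δ 0` instead of passing it.
  obtain ⟨i, hi⟩ : ∃ i : Fin (m + 1), SimplexCategory.δ j.succ ≫ SimplexCategory.σ i.succ = 𝟙 _ := by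
    induction j using Fin.cases with
    | zero => exact ⟨0, SimplexCategory.δ_comp_σ_self (i := 1)⟩
    | succ i => exact ⟨i, SimplexCategory.δ_comp_σ_succ⟩
  have h1 := congrArg (fun x => IsoClass.map (redPull k X (SimplexCategory.σ i.succ)) x.1) h
  simp only [localCoface, map_redPull_map, hi, map_redPull_id] at h1
  have h2 : SimplexCategory.δ 0 ≫ SimplexCategory.σ i.succ =
      SimplexCategory.σ i ≫ SimplexCategory.δ 0 :=
    SimplexCategory.δ_comp_σ_of_le (i := 0) (Fin.zero_le _)
  rw [h2, ← map_redPull_map] at h1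
  refine ⟨⟨IsoClass.map (redPull k X (SimplexCategory.σ i)) y.1, ?_⟩, Subtype.ext h1.symm⟩
  rw [← IsoClass.isLocal_map_iff (redPull k X (SimplexCategory.δ 0)), ← h1]
  exact x.2

theorem eq_of_localCoface_eq (x y : LocalClass (RedMod k X ⦋0⦌))
    (h : localCoface k X 0 1 x = localCoface k X 0 0 y) : x = y := by
  have h1 := congrArg (fun x => IsoClass.map (redPull k X (SimplexCategory.σ 0)) x.1) h
  have h2 : SimplexCategory.δ (1 : Fin 2) ≫ SimplexCategory.σ 0 = 𝟙 _ :=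
    SimplexCategory.δ_comp_σ_succ (i := 0)
  have h3 : SimplexCategory.δ (0 : Fin 2) ≫ SimplexCategory.σ 0 = 𝟙 _ :=
    SimplexCategory.δ_comp_σ_self (i := 0)
  simp only [localCoface, map_redPull_map, h2, h3, map_redPull_id] at h1
  exact Subtype.ext h1

/-- The cofaces on the Grothendieck groups of reduced modules. -/
abbrev redCoface (m : ℕ) (i : Fin (m + 2)) :
    SplitGr (RedMod k X ⦋m⦌) →+ SplitGr (RedMod k X ⦋m + 1⦌) :=
  SplitGr.map (redPull k X (SimplexCategory.δ i))

variable (hKS : ∀ m : ℕ, IsKrullSchmidt (RedMod k X ⦋m⦌))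

include hKS

theorem redCoface_localBasis (m : ℕ) (i : Fin (m + 2)) (c : LocalClass (RedMod k X ⦋m⦌)) :
    redCoface k X m i (localBasis (hKS m) c) = localBasis (hKS (m + 1)) (localCoface k X m i c) := by
  obtain ⟨c, hc⟩ := c
  obtain ⟨M, rfl⟩ := IsoClass.exists_rep c
  rw [localBasis_apply, localBasis_apply]
  exact SplitGr.map_of _ _

/-- The reduced representation complex is exact in positive degrees. -/
theorem exact_redCoface (m : ℕ) (a : SplitGr (RedMod k X ⦋m + 1⦌))
    (ha : altSum (redCoface k X) (m + 1) a = 0) : ∃ c, altSum (redCoface k X) m c = a :=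
  exact_of_basis (fun m => localBasis (hKS m)) (redCoface_localBasis k X hKS)
    (fun m => localCoface_injective k X m 0) (localCoface_comm k X) (exists_localCoface_eq k X) m a ha

theorem mem_closure_of_redCoface (a : SplitGr (RedMod k X ⦋0⦌))
    (ha : altSum (redCoface k X) 0 a = 0) :
    a ∈ AddSubgroup.closure {c | ∃ M : ModAt k X ⦋0⦌,
      Nonempty ((toImage (toZero k X ⦋1⦌)).obj ((pull k X (SimplexCategory.δ 0)).obj M) ≅
        (toImage (toZero k X ⦋1⦌)).obj ((pull k X (SimplexCategory.δ 1)).obj M)) ∧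
      c = Algebra.GrothendieckAddGroup.of (IsoClass.mk ((toImage (toZero k X ⦋0⦌)).obj M))} := by
  refine AddSubgroup.closure_mono ?_ (mem_span_of_basis (fun m => localBasis (hKS m))
    (redCoface_localBasis k X hKS) (fun m => localCoface_injective k X m 0)
    (eq_of_localCoface_eq k X) a ha)
  rintro _ ⟨⟨c, hc⟩, h, rfl⟩
  obtain ⟨M, rfl⟩ := IsoClass.exists_rep c
  refine ⟨M.as, IsoClass.mk_eq_mk_iff.1 (congrArg Subtype.val h), localBasis_apply _ _⟩

end Simplicial

/-! ### Dimension vectors -/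

section Dimension

open Opposite Simplicial

variable (k : Type u) [Field k]

theorem FGModuleCat.isZero_of_finrank {V : FGModuleCat.{u} k} (h : Module.finrank k V = 0) :
    IsZero V := by
  have : Subsingleton V := Module.finrank_zero_iff.1 h
  rw [IsZero.iff_id_eq_zero]
  ext x
  exact Subsingleton.elim _ _

theorem FGModuleCat.finrank_of_isZero {V : FGModuleCat.{u} k} (h : IsZero V) :
    Module.finrank k V = 0 := by
  have hsub : ∀ x : V, x = 0 := fun x =>
    congrArg (fun f : V ⟶ V => f.hom x) ((IsZero.iff_id_eq_zero V).1 h)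
  have : Subsingleton V := ⟨fun x y => by rw [hsub x, hsub y]⟩
  exact Module.finrank_zero_of_subsingleton

/-- The dimension of a finite dimensional vector space, as an additive invariant. -/
def finrankHom : IsoClass (FGModuleCat.{u} k) →+ ℕ where
  toFun := Quotient.lift (s := isIsomorphicSetoid (FGModuleCat.{u} k))
    (fun V => Module.finrank k V) fun _ _ ⟨e⟩ => (FGModuleCat.isoToLinearEquiv e).finrank_eq
  map_zero' := FGModuleCat.finrank_of_isZero k (isZero_zero _)
  map_add' x y := by
    obtain ⟨V, rfl⟩ := IsoClass.exists_rep x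
    obtain ⟨W, rfl⟩ := IsoClass.exists_rep y
    change Module.finrank k (V ⊞ W : FGModuleCat k) = Module.finrank k V + Module.finrank k W
    have h1 : ∀ v : V, (biprod.fst : V ⊞ W ⟶ V).hom ((biprod.inl : V ⟶ V ⊞ W).hom v) = v := fun v =>
      congrArg (fun f : V ⟶ V => f.hom v) (biprod.inl_fst (X := V) (Y := W))
    have h2 : ∀ v : V, (biprod.snd : V ⊞ W ⟶ W).hom ((biprod.inl : V ⟶ V ⊞ W).hom v) = 0 := fun v =>
      congrArg (fun f : V ⟶ W => f.hom v) (biprod.inl_snd (X := V) (Y := W))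
    have h3 : ∀ v : W, (biprod.fst : V ⊞ W ⟶ V).hom ((biprod.inr : W ⟶ V ⊞ W).hom v) = 0 := fun v =>
      congrArg (fun f : W ⟶ V => f.hom v) (biprod.inr_fst (X := V) (Y := W))
    have h4 : ∀ v : W, (biprod.snd : V ⊞ W ⟶ W).hom ((biprod.inr : W ⟶ V ⊞ W).hom v) = v := fun v =>
      congrArg (fun f : W ⟶ W => f.hom v) (biprod.inr_snd (X := V) (Y := W))
    have h5 : ∀ z : (V ⊞ W : FGModuleCat k), (biprod.inl : V ⟶ V ⊞ W).hom
        ((biprod.fst : V ⊞ W ⟶ V).hom z) + (biprod.inr : W ⟶ V ⊞ W).hom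
        ((biprod.snd : V ⊞ W ⟶ W).hom z) = z := fun z =>
      congrArg (fun f : V ⊞ W ⟶ V ⊞ W => f.hom z) (biprod.total (X := V) (Y := W))
    let e : (V ⊞ W : FGModuleCat k) ≃ₗ[k] V × W :=
      { (biprod.fst : V ⊞ W ⟶ V).hom.hom.prod (biprod.snd : V ⊞ W ⟶ W).hom.hom with
        invFun := fun p => (biprod.inl : V ⟶ V ⊞ W).hom p.1 + (biprod.inr : W ⟶ V ⊞ W).hom p.2
        left_inv := fun z => h5 z
        right_inv := fun p => by
          refine Prod.ext ?_ ?_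
          · change (biprod.fst : V ⊞ W ⟶ V).hom ((biprod.inl : V ⟶ V ⊞ W).hom p.1 +
              (biprod.inr : W ⟶ V ⊞ W).hom p.2) = p.1
            rw [map_add, h1, h3, add_zero]
          · change (biprod.snd : V ⊞ W ⟶ W).hom ((biprod.inl : V ⟶ V ⊞ W).hom p.1 +
              (biprod.inr : W ⟶ V ⊞ W).hom p.2) = p.2
            rw [map_add, h2, h4, zero_add] }
    rw [e.finrank_eq, Module.finrank_prod]

theorem finrankHom_mk (V : FGModuleCat.{u} k) : finrankHom k (IsoClass.mk V) = Module.finrank k V :=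
  rfl

variable {C : Type w} [Category.{v} C]

/-- The dimension of a module at an object. -/
def dimAt (x : C) : IsoClass (CatMod k C) →+ ℕ :=
  (finrankHom k).comp (IsoClass.map ((evaluation C (FGModuleCat.{u} k)).obj x))

/-- The dimension vector of a class in the Grothendieck group. -/
def dimVec (C : Type w) [Category.{v} C] : SplitGr (CatMod k C) →+ (C → ℤ) :=
  Algebra.GrothendieckAddGroup.lift
    { toFun := fun c x => (dimAt k x c : ℤ)
      map_zero' := by ext; simp
      map_add' := fun _ _ => by ext; simp }

theorem dimVec_of (M : CatMod k C) (x : C) :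
    dimVec k C (Algebra.GrothendieckAddGroup.of (IsoClass.mk M)) x = Module.finrank k (M.obj x) :=
  congrFun (DFunLike.congr_fun (Algebra.GrothendieckAddGroup.lift.symm_apply_apply _)
    (IsoClass.mk M)) x

theorem dimVec_map {C' : Type*} [Category* C'] (F : C' ⥤ C) (z : SplitGr (CatMod k C)) (x : C') :
    dimVec k C' (SplitGr.map ((Functor.whiskeringLeft _ _ (FGModuleCat.{u} k)).obj F) z) x =
      dimVec k C z (F.obj x) := by
  obtain ⟨M, N, rfl⟩ := SplitGr.exists_eq_sub z
  simp only [map_sub, SplitGr.map_of, Pi.sub_apply, dimVec_of]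
  rfl

/-- The total dimension of a module over a category with finitely many objects. -/
def totalDim (C : Type w) [Category.{v} C] [Fintype C] : IsoClass (CatMod k C) →+ ℕ :=
  ∑ x : C, dimAt k x

theorem isZero_of_dimAt {M : CatMod k C} (h : ∀ x, dimAt k x (IsoClass.mk M) = 0) : IsZero M :=
  Functor.isZero _ fun x => FGModuleCat.isZero_of_finrank k (h x)

theorem isZero_of_totalDim [Fintype C] (M : CatMod k C) (h : totalDim k C (IsoClass.mk M) = 0) :
    IsZero M := by
  refine isZero_of_dimAt k fun x => ?_
  rw [totalDim, AddMonoidHom.finsetSum_apply] at h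
  exact Finset.sum_eq_zero_iff.1 h x (Finset.mem_univ x)

instance [Finite C] (M N : CatMod k C) : Module.Finite k (M ⟶ N) := by
  let φ : (M ⟶ N) →ₗ[k] ((x : C) → (M.obj x ⟶ N.obj x)) :=
    { toFun := fun f x => f.app x
      map_add' := fun _ _ => rfl
      map_smul' := fun _ _ => rfl }
  exact Module.Finite.of_injective φ fun f g h => NatTrans.ext h

theorem hasFitting_catMod [Finite C] : HasFitting (CatMod k C) := hasFitting k

/-- The length function is the total dimension of the restriction to dimension zero. -/
theorem isKrullSchmidt_redMod (X : SimplicialObject Cat.{v, w}) (n : SimplexCategory)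
    [Finite (X.obj (op n))] [Finite (X.obj (op ⦋0⦌))] : IsKrullSchmidt (RedMod k X n) := by
  have := Fintype.ofFinite (X.obj (op ⦋0⦌))
  exact isKrullSchmidt_imageCat _ (hasFitting_catMod k) (totalDim k _) (isZero_of_totalDim k)

theorem exists_of_map_toImage_eq_zero (X : SimplicialObject Cat.{v, w}) (n : SimplexCategory)
    [Finite (X.obj (op n))] [Finite (X.obj (op ⦋0⦌))] (z : SplitGr (ModAt k X n))
    (hz : SplitGr.map (toImage (toZero k X n)) z = 0) :
    ∃ M N : ModAt k X n, IsZero ((toZero k X n).obj M) ∧ IsZero ((toZero k X n).obj N) ∧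
      z = Algebra.GrothendieckAddGroup.of (IsoClass.mk M) -
        Algebra.GrothendieckAddGroup.of (IsoClass.mk N) := by
  have := Fintype.ofFinite (X.obj (op ⦋0⦌))
  exact SplitGr.exists_of_map_toImage_eq_zero _ (hasFitting_catMod k) (totalDim k _)
    (isZero_of_totalDim k) z hz

/-- The class of a vector space is a multiple of the class of the line. -/
theorem of_mk_eq_finrank_smul (V : FGModuleCat.{u} k) :
    (Algebra.GrothendieckAddGroup.of (IsoClass.mk V) : SplitGr (FGModuleCat.{u} k)) =
      Module.finrank k V • Algebra.GrothendieckAddGroup.of (IsoClass.mk (FGModuleCat.of k k)) := by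
  have key : ∀ (n : ℕ) (W : FGModuleCat.{u} k), Module.finrank k W = n →
      IsoClass.mk W = n • IsoClass.mk (FGModuleCat.of k k) := by
    intro n
    induction n with
    | zero =>
      intro W hW
      rw [zero_nsmul]
      exact IsoClass.mk_eq_zero (FGModuleCat.isZero_of_finrank k hW)
    | succ n ih =>
      intro W hW
      rw [succ_nsmul, ← ih (FGModuleCat.of k (ULift.{u} (Fin n) → k)) (by simp), ← IsoClass.mk_biprod]
      refine IsoClass.mk_eq_mk_iff.2 ⟨LinearEquiv.toFGModuleCatIso (LinearEquiv.ofFinrankEq _ _ ?_)⟩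
      rw [hW]
      have h := map_add (finrankHom k) (IsoClass.mk (FGModuleCat.of k (ULift.{u} (Fin n) → k)))
        (IsoClass.mk (FGModuleCat.of k k))
      rw [← IsoClass.mk_biprod, finrankHom_mk, finrankHom_mk, finrankHom_mk] at h
      rw [h]
      simp
  rw [key _ V rfl, map_nsmul]

end Dimension

/-! ### Representation cohomology in terms of cocycles -/

section Cocycles

open Opposite Simplicial

/-- The map `ψ` picks cocycle representatives, and the hypotheses say that it is bijective onto
cocycles modulo coboundaries. Later arguments then deal with elements only. -/
theorem nonempty_homology_addEquiv (S : ShortComplex AddCommGrpCat.{u}) {G : Type*}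
    [AddCommGroup G] (ψ : G →+ S.X₂) (hψ : ∀ g, S.g (ψ g) = 0)
    (hsurj : ∀ a, S.g a = 0 → ∃ g c, a = ψ g + S.f c) (hinj : ∀ g c, ψ g = S.f c → g = 0) :
    Nonempty (S.homology ≃+ G) := by
  let φ : G →+ S.g.hom.ker ⧸ S.abToCycles.range :=
    (QuotientAddGroup.mk' S.abToCycles.range).comp (ψ.codRestrict S.g.hom.ker hψ)
  have hφ : Function.Bijective φ := by
    constructor
    · rw [injective_iff_map_eq_zero]
      intro g hg
      obtain ⟨c, hc⟩ := (QuotientAddGroup.eq_zero_iff _).1 hg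
      exact hinj g c (congrArg Subtype.val hc).symm
    · intro q
      obtain ⟨⟨a, ha⟩, rfl⟩ := QuotientAddGroup.mk_surjective q
      obtain ⟨g, c, hgc⟩ := hsurj a ha
      refine ⟨g, QuotientAddGroup.eq.2 ⟨c, Subtype.ext ?_⟩⟩
      change S.f c = -ψ g + a
      rw [hgc]; abel
  exact ⟨S.abHomologyIso.addCommGroupIsoToAddEquiv.trans (AddEquiv.ofBijective φ hφ).symm⟩

variable (k : Type u) [Field k] (X : SimplicialObject Cat.{v, w})

/-- The cofaces of the representation complex. -/
abbrev coface (m : ℕ) (i : Fin (m + 2)) :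
    SplitGr (ModAt k X ⦋m⦌) →+ SplitGr (ModAt k X ⦋m + 1⦌) :=
  SplitGr.map (pull k X (SimplexCategory.δ i))

theorem repComplex_d_apply (m : ℕ) (a : SplitGr (ModAt k X ⦋m⦌)) :
    ((repComplex k X).d m (m + 1)).hom a = altSum (coface k X) m a := by
  have h : (repComplex k X).d m (m + 1) =
      ∑ i : Fin (m + 2), (-1 : ℤ) ^ (i : ℕ) • (grCosimplicial k X).δ i :=
    CochainComplex.of_d (fun n => (grCosimplicial k X).obj ⦋n⦌)
      (AlgebraicTopology.AlternatingCofaceMapComplex.objD (grCosimplicial k X)) m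
  have h' : ((repComplex k X).d m (m + 1)).hom =
      ∑ i : Fin (m + 2), (-1 : ℤ) ^ (i : ℕ) • ((grCosimplicial k X).δ i).hom := by
    rw [h]
    exact map_sum AddCommGrpCat.homAddEquiv _ _
  rw [h', altSum]
  rfl

theorem nonempty_repCohomology_zero_addEquiv {G : Type*} [AddCommGroup G]
    (ψ : G →+ SplitGr (ModAt k X ⦋0⦌)) (hψ : ∀ g, altSum (coface k X) 0 (ψ g) = 0)
    (hsurj : ∀ a, altSum (coface k X) 0 a = 0 → ∃ g, a = ψ g) (hinj : ∀ g, ψ g = 0 → g = 0) :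
    Nonempty (repCohomology k X 0 ≃+ G) := by
  -- The predecessor of index `0` is taken to be `0` itself, and the differential `d 0 0` is zero.
  obtain ⟨e⟩ := nonempty_homology_addEquiv ((repComplex k X).sc' 0 0 1) ψ
    (fun g => (repComplex_d_apply k X 0 _).trans (hψ g))
    (fun a ha => by
      obtain ⟨g, hg⟩ := hsurj a ((repComplex_d_apply k X 0 _).symm.trans ha)
      exact ⟨g, 0, hg.trans (by rw [map_zero]; exact (add_zero _).symm)⟩)
    (fun g c h => hinj g (by
      have h0 : (repComplex k X).d 0 0 = 0 := (repComplex k X).shape _ _ (by simp)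
      have h1 : ((repComplex k X).sc' 0 0 1).f = 0 := h0
      rw [h1] at h; exact h))
  exact ⟨(ShortComplex.homologyMapIso ((repComplex k X).isoSc' 0 0 1 (by simp)
    (by simp))).addCommGroupIsoToAddEquiv.trans e⟩

theorem nonempty_repCohomology_succ_addEquiv (m : ℕ) {G : Type*} [AddCommGroup G]
    (ψ : G →+ SplitGr (ModAt k X ⦋m + 1⦌)) (hψ : ∀ g, altSum (coface k X) (m + 1) (ψ g) = 0)
    (hsurj : ∀ a, altSum (coface k X) (m + 1) a = 0 → ∃ g c, a = ψ g + altSum (coface k X) m c)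
    (hinj : ∀ g c, ψ g = altSum (coface k X) m c → g = 0) :
    Nonempty (repCohomology k X (m + 1) ≃+ G) := by
  obtain ⟨e⟩ := nonempty_homology_addEquiv ((repComplex k X).sc' m (m + 1) (m + 2)) ψ
    (fun g => (repComplex_d_apply k X _ _).trans (hψ g))
    (fun a ha => by
      obtain ⟨g, c, rfl⟩ := hsurj a ((repComplex_d_apply k X _ _).symm.trans ha)
      exact ⟨g, c, congrArg _ (repComplex_d_apply k X _ _).symm⟩)
    (fun g c h => hinj g c (h.trans (repComplex_d_apply k X _ _)))
  exact ⟨(ShortComplex.homologyMapIso ((repComplex k X).isoSc' m (m + 1) (m + 2) (by simp)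
    (by simp))).addCommGroupIsoToAddEquiv.trans e⟩

theorem subsingleton_repCohomology_succ (m : ℕ)
    (h : ∀ a, altSum (coface k X) (m + 1) a = 0 → ∃ c, altSum (coface k X) m c = a) :
    Subsingleton (repCohomology k X (m + 1)) := by
  obtain ⟨e⟩ := nonempty_repCohomology_succ_addEquiv k X m (G := Unit) 0 (by simp)
    (fun a ha => by obtain ⟨c, rfl⟩ := h a ha; exact ⟨0, c, by simp⟩) (fun _ _ _ => rfl)
  exact e.injective.subsingleton

end Cocycles

/-! ### Constant modules and cohomology in degree zero -/

section Constant

open Opposite Simplicial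

variable (k : Type u) [Field k] (C : Type w) [Category.{v} C]

/-- The class of the constant module of dimension one. -/
def constClass : SplitGr (CatMod k C) :=
  Algebra.GrothendieckAddGroup.of (IsoClass.mk ((Functor.const C).obj (FGModuleCat.of k k)))

instance : (Functor.const C : FGModuleCat.{u} k ⥤ CatMod k C).Additive where
  map_add := rfl

theorem of_mk_const (V : FGModuleCat.{u} k) :
    (Algebra.GrothendieckAddGroup.of (IsoClass.mk ((Functor.const C).obj V)) :
      SplitGr (CatMod k C)) = Module.finrank k V • constClass k C := by
  rw [← SplitGr.map_of (Functor.const C), of_mk_eq_finrank_smul, map_nsmul, SplitGr.map_of]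
  rfl

theorem dimVec_constClass (x : C) : dimVec k C (constClass k C) x = 1 := by
  rw [constClass, dimVec_of]
  exact congrArg Nat.cast (Module.finrank_self k)

variable {C} {C' : Type*} [Category* C'] {C'' : Type*} [Category* C'']

/-- The homomorphism of Grothendieck groups induced by a functor. -/
def grMap (F : C ⥤ C') : SplitGr (CatMod k C') →+ SplitGr (CatMod k C) :=
  SplitGr.map ((Functor.whiskeringLeft _ _ (FGModuleCat.{u} k)).obj F)

theorem grMap_id (a : SplitGr (CatMod k C)) : grMap k (𝟭 C) a = a :=
  DFunLike.congr_fun SplitGr.map_id a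

theorem grMap_grMap (F : C ⥤ C') (G : C' ⥤ C'') (a : SplitGr (CatMod k C'')) :
    grMap k F (grMap k G a) = grMap k (F ⋙ G) a :=
  (DFunLike.congr_fun (SplitGr.map_comp ((Functor.whiskeringLeft _ _ (FGModuleCat.{u} k)).obj G)
    ((Functor.whiskeringLeft _ _ (FGModuleCat.{u} k)).obj F)) a).symm

/-- Pulling back along a constant functor sees a module only through one value, hence through one
dimension. -/
theorem grMap_const (c : C') (a : SplitGr (CatMod k C')) :
    grMap k ((Functor.const C).obj c) a = dimVec k C' a c • constClass k C := by
  have h : ∀ M : CatMod k C', grMap k ((Functor.const C).obj c)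
      (Algebra.GrothendieckAddGroup.of (IsoClass.mk M)) =
      Module.finrank k (M.obj c) • constClass k C := fun M => by
    rw [grMap, SplitGr.map_of, ← of_mk_const]
    congr 1
    exact IsoClass.mk_eq_mk_iff.2 ⟨NatIso.ofComponents (fun _ => Iso.refl _) (by simp)⟩
  obtain ⟨M, N, rfl⟩ := SplitGr.exists_eq_sub a
  rw [map_sub, h, h, map_sub, Pi.sub_apply, dimVec_of, dimVec_of, sub_smul, natCast_zsmul,
    natCast_zsmul]

variable (X : SimplicialObject Cat.{v, w})

theorem coface_eq_grMap (m : ℕ) (i : Fin (m + 2)) :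
    coface k X m i = grMap k (X.map (SimplexCategory.δ i).op).toFunctor := rfl

theorem coface_constClass (m : ℕ) (i : Fin (m + 2)) :
    coface k X m i (constClass k _) = constClass k _ :=
  SplitGr.map_of _ _

theorem nonempty_repCohomology_zero_addEquiv_int [Nonempty (X.obj (op ⦋0⦌))]
    (h : ∀ a, altSum (coface k X) 0 a = 0 → ∃ z : ℤ, a = z • constClass k _) :
    Nonempty (repCohomology k X 0 ≃+ ℤ) := by
  refine nonempty_repCohomology_zero_addEquiv k X
    (zmultiplesHom (SplitGr (ModAt k X ⦋0⦌)) (constClass k _)) (fun z => ?_) h (fun z hz => ?_)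
  · rw [zmultiplesHom_apply, map_zsmul, altSum_apply, Fin.sum_univ_two, coface_constClass,
      coface_constClass]
    simp
  · obtain ⟨x⟩ := ‹Nonempty (X.obj (op ⦋0⦌))›
    have := congrFun (congrArg (dimVec k _) hz) x
    rw [zmultiplesHom_apply, map_zsmul, map_zero, Pi.smul_apply, dimVec_constClass] at this
    simpa using this

end Constant

/-! ### The extra degeneracy of the simplicial envelope of `[n]` -/

section Envelope

open Opposite Simplicial

variable {n : ℕ}

theorem composableArrows_ext {m : ℕ} {x y : ComposableArrows (Fin (n + 1)) m}
    (h : ∀ i, x.obj i = y.obj i) : x = y :=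
  CategoryTheory.Functor.ext h fun _ _ _ => Subsingleton.elim _ _

instance composableArrows_subsingleton {m : ℕ} (x y : ComposableArrows (Fin (n + 1)) m) :
    Subsingleton (x ⟶ y) :=
  ⟨fun _ _ => NatTrans.ext (funext fun _ => Subsingleton.elim _ _)⟩

/-- Tuples in a poset form a thin category, so the identities of the extra degeneracy can be checked
on objects as strict equalities. -/
theorem envelope_functor_ext {D : Type*} [Category* D] {m : SimplexCategoryᵒᵖ}
    {F G : D ⥤ (envelope (Fin (n + 1))).obj m} (h : ∀ d, F.obj d = G.obj d) : F = G :=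
  CategoryTheory.Functor.ext h fun a b _ =>
    (composableArrows_subsingleton (F.obj a) (F.obj b)).elim _ _

/-- Prepending the least element. -/
def prepend {m : ℕ} (x : ComposableArrows (Fin (n + 1)) m) :
    ComposableArrows (Fin (n + 1)) (m + 1) :=
  x.precomp (homOfLE (Fin.zero_le x.left))

theorem prepend_obj_zero {m : ℕ} (x : ComposableArrows (Fin (n + 1)) m) :
    (prepend x).obj 0 = 0 := rfl

theorem prepend_obj_succ {m : ℕ} (x : ComposableArrows (Fin (n + 1)) m) (i : Fin (m + 1)) :
    (prepend x).obj i.succ = x.obj i := rfl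

/-- Prepending the least element, as a functor. -/
def prependFunctor (n m : ℕ) : (envelope (Fin (n + 1))).obj (op ⦋m⦌) ⥤
    (envelope (Fin (n + 1))).obj (op ⦋m + 1⦌) where
  obj := prepend
  map {x y} f :=
    { app := fun i => homOfLE (by
        induction i using Fin.cases with
        | zero => exact le_rfl
        | succ i => exact leOfHom (f.app i))
      naturality := fun _ _ _ => Subsingleton.elim _ _ }

/-- The face `∂ i` of a tuple. -/
abbrev face {m : ℕ} (i : Fin (m + 2)) (x : ComposableArrows (Fin (n + 1)) (m + 1)) :
    ComposableArrows (Fin (n + 1)) m :=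
  ((envelope (Fin (n + 1))).map (SimplexCategory.δ i).op).toFunctor.obj x

theorem face_obj {m : ℕ} (i : Fin (m + 2)) (x : ComposableArrows (Fin (n + 1)) (m + 1))
    (t : Fin (m + 1)) : (face i x).obj t = x.obj (i.succAbove t) := rfl

theorem face_zero_prepend {m : ℕ} (x : ComposableArrows (Fin (n + 1)) m) :
    face 0 (prepend x) = x :=
  composableArrows_ext fun t => by rw [face_obj, Fin.zero_succAbove, prepend_obj_succ]

theorem face_succ_prepend {m : ℕ} (j : Fin (m + 2)) (x : ComposableArrows (Fin (n + 1)) (m + 1)) :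
    face j.succ (prepend x) = prepend (face j x) := by
  refine composableArrows_ext fun t => ?_
  induction t using Fin.cases with
  | zero => rw [face_obj, Fin.succ_succAbove_zero, prepend_obj_zero, prepend_obj_zero]
  | succ t => rw [face_obj, Fin.succ_succAbove_succ, prepend_obj_succ, prepend_obj_succ, face_obj]

variable (k : Type u) [Field k]

/-- The contraction of the representation complex. -/
def envelopeContraction (n m : ℕ) :
    SplitGr (ModAt k (envelope (Fin (n + 1))) ⦋m + 1⦌) →+
      SplitGr (ModAt k (envelope (Fin (n + 1))) ⦋m⦌) :=
  grMap k (prependFunctor n m)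

theorem envelopeContraction_coface_zero (m : ℕ)
    (a : SplitGr (ModAt k (envelope (Fin (n + 1))) ⦋m⦌)) :
    envelopeContraction k n m (coface k _ m 0 a) = a := by
  have h : prependFunctor n m ⋙
      ((envelope (Fin (n + 1))).map (SimplexCategory.δ (0 : Fin (m + 2))).op).toFunctor = 𝟭 _ :=
    envelope_functor_ext face_zero_prepend
  rw [envelopeContraction, coface_eq_grMap, grMap_grMap, h, grMap_id]

theorem envelopeContraction_coface_succ (m : ℕ) (j : Fin (m + 2))
    (a : SplitGr (ModAt k (envelope (Fin (n + 1))) ⦋m + 1⦌)) :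
    envelopeContraction k n (m + 1) (coface k _ (m + 1) j.succ a) =
      coface k _ m j (envelopeContraction k n m a) := by
  have h : prependFunctor n (m + 1) ⋙
      ((envelope (Fin (n + 1))).map (SimplexCategory.δ j.succ).op).toFunctor =
      ((envelope (Fin (n + 1))).map (SimplexCategory.δ j).op).toFunctor ⋙ prependFunctor n m :=
    envelope_functor_ext (face_succ_prepend j)
  rw [envelopeContraction, envelopeContraction, coface_eq_grMap, coface_eq_grMap, grMap_grMap,
    grMap_grMap, h]

/-- Applying the contraction `h` to `d a = 0` gives `a - d (h a) = 0`, by the two commutation rules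
with cofaces. -/
theorem subsingleton_envelopeCohomology (n m : ℕ) :
    Subsingleton (envelopeCohomology (Fin (n + 1)) k (m + 1)) := by
  refine subsingleton_repCohomology_succ k _ m fun a ha => ⟨envelopeContraction k n m a, ?_⟩
  have h := congrArg (envelopeContraction k n (m + 1)) ha
  rw [altSum_apply, Fin.sum_univ_succ, map_add, map_zsmul, envelopeContraction_coface_zero,
    map_sum, map_zero] at h
  simp only [map_zsmul, map_neg, envelopeContraction_coface_succ, Fin.val_succ, pow_succ,
    mul_neg_one, neg_smul, Finset.sum_neg_distrib, Fin.val_zero, pow_zero, one_smul] at h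
  rw [altSum_apply]
  exact (add_neg_eq_zero.1 h).symm

theorem nonempty_envelopeCohomology_zero (n : ℕ) :
    Nonempty (envelopeCohomology (Fin (n + 1)) k 0 ≃+ ℤ) := by
  let x₀ : (envelope (Fin (n + 1))).obj (op ⦋0⦌) :=
    (ComposableArrows.mk₀ 0 : ComposableArrows (Fin (n + 1)) 0)
  have : Nonempty ((envelope (Fin (n + 1))).obj (op ⦋0⦌)) := ⟨x₀⟩
  refine nonempty_repCohomology_zero_addEquiv_int k _ fun a ha => ⟨dimVec k _ a x₀, ?_⟩
  rw [altSum_apply, Fin.sum_univ_two] at ha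
  simp only [Fin.val_zero, Fin.val_one, pow_zero, pow_one, one_smul, neg_smul] at ha
  have h := congrArg (envelopeContraction k n 0) (add_neg_eq_zero.1 ha)
  -- Deleting the entry of a prepended 0-simplex leaves the least element. Equality of the cofaces
  -- of `a` therefore identifies `a` with its pullback along a constant functor.
  have hF : prependFunctor n 0 ⋙
      ((envelope (Fin (n + 1))).map (SimplexCategory.δ (1 : Fin 2)).op).toFunctor =
      (Functor.const _).obj x₀ :=
    envelope_functor_ext fun x => composableArrows_ext fun t : Fin 1 => by
      obtain rfl : t = 0 := Subsingleton.elim _ _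
      rfl
  rw [envelopeContraction_coface_zero, envelopeContraction, coface_eq_grMap, grMap_grMap, hF,
    grMap_const] at h
  exact h

end Envelope

/-! ### The compositional envelope of `[n]` -/

section CompEnvelope

open Opposite Simplicial

variable {n : ℕ}

/-- The category of `m`-simplices of the compositional envelope of `[n]`. -/
abbrev CompCat (n m : ℕ) : Cat := (compEnvelope (Fin (n + 1))).obj (op ⦋m⦌)

/-- The object of the compositional envelope given by a tuple. -/
def compObj {m : ℕ} (x : ComposableArrows (Fin (n + 1)) m) : CompCat n m :=
  (⟨x⟩ : WideSubcategory (compositional (Fin (n + 1)) m))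

/-- The tuple underlying an object of the compositional envelope. -/
def tuple {m : ℕ} (x : CompCat n m) : ComposableArrows (Fin (n + 1)) m :=
  WideSubcategory.obj (_P := compositional (Fin (n + 1)) m) x

theorem compObj_tuple {m : ℕ} (x : CompCat n m) : compObj (tuple x) = x := rfl

theorem tuple_compObj {m : ℕ} (x : ComposableArrows (Fin (n + 1)) m) : tuple (compObj x) = x := rfl

theorem compCat_ext {m : ℕ} {x y : CompCat n m} (h : ∀ i, (tuple x).obj i = (tuple y).obj i) :
    x = y :=
  congrArg compObj (composableArrows_ext h)

instance compCat_subsingleton {m : ℕ} (x y : CompCat n m) : Subsingleton (x ⟶ y) :=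
  ⟨fun _ _ => InducedWideCategory.Hom.ext
    ((composableArrows_subsingleton (tuple x) (tuple y)).elim _ _)⟩

theorem tuple_le {m : ℕ} {x y : CompCat n m} (f : x ⟶ y) (i : Fin (m + 1)) :
    (tuple x).obj i ≤ (tuple y).obj i :=
  leOfHom ((InducedWideCategory.Hom.hom f).app i)

theorem compCat_antisymm {m : ℕ} {x y : CompCat n m} (f : x ⟶ y) (g : y ⟶ x) : x = y :=
  compCat_ext fun i => le_antisymm (tuple_le f i) (tuple_le g i)

instance (n m : ℕ) : Finite (CompCat n m) :=
  Finite.of_injective (fun x (i : Fin (m + 1)) => (tuple x).obj i)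
    fun _ _ h => compCat_ext fun i => congrFun h i

/-- The morphism induced by a relation between the last and the first entry. -/
def compHom {m : ℕ} {x y : CompCat n m} (h : (tuple x).obj (Fin.last m) ≤ (tuple y).obj 0) :
    x ⟶ y :=
  InducedWideCategory.Hom.mk (inducedHom (x := tuple x) (y := tuple y) (homOfLE h)) (.induced _)

/-- The constant tuples. -/
def constTuple (n m : ℕ) (c : Fin (n + 1)) : ComposableArrows (Fin (n + 1)) m :=
  (Functor.const _).obj c

theorem constTuple_obj (m : ℕ) (c : Fin (n + 1)) (i : Fin (m + 1)) :
    (constTuple n m c).obj i = c := rfl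

/-- A non-identity morphism is induced by `x_m ≤ y_0`, so it passes through the constant tuple at
`x_m`. This is the feature of the compositional envelope on which the computation rests. -/
theorem exists_factor_of_ne {m : ℕ} {x y : CompCat n m} (f : x ⟶ y) (h : x ≠ y) :
    ∃ (c : Fin (n + 1)) (p : x ⟶ compObj (constTuple n m c)) (q : compObj (constTuple n m c) ⟶ y),
      f = p ≫ q := by
  have hle : (tuple x).obj (Fin.last m) ≤ (tuple y).obj 0 := by
    obtain ⟨x⟩ := x
    obtain ⟨y⟩ := y
    obtain ⟨f, hf⟩ := f
    cases hf with
    | id => exact absurd rfl h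
    | induced g => exact leOfHom g
  exact ⟨(tuple x).obj (Fin.last m), compHom le_rfl, compHom hle, Subsingleton.elim _ _⟩

theorem compEnvelope_map_toZero (m : ℕ) (y : CompCat n 0) :
    ((compEnvelope (Fin (n + 1))).map
      (SimplexCategory.isTerminalZero.from ⦋m⦌).op).toFunctor.obj y =
        compObj (constTuple n m ((tuple y).obj 0)) :=
  compCat_ext fun _ => congrArg (tuple y).obj (Subsingleton.elim (α := Fin 1) _ _)

variable (k : Type u) [Field k]

/-- The modules over the `m`-simplices of the compositional envelope of `[n]`. -/
abbrev CompMod (n m : ℕ) : Type _ := ModAt k (compEnvelope (Fin (n + 1))) ⦋m⦌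

variable {k}

theorem isZero_toZero_iff {m : ℕ} (M : CompMod k n m) :
    IsZero ((toZero k (compEnvelope (Fin (n + 1))) ⦋m⦌).obj M) ↔
      ∀ c, IsZero (M.obj (compObj (constTuple n m c))) := by
  constructor
  · intro h c
    exact h.obj (compObj (constTuple n 0 c))
  · intro h
    refine Functor.isZero _ fun y => ?_
    change IsZero (M.obj _)
    rw [compEnvelope_map_toZero]
    exact h _

theorem map_eq_zero_of_ne {m : ℕ} {M : CompMod k n m}
    (hM : ∀ c, IsZero (M.obj (compObj (constTuple n m c)))) {x y : CompCat n m} (f : x ⟶ y)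
    (h : x ≠ y) : M.map f = 0 := by
  obtain ⟨c, p, q, rfl⟩ := exists_factor_of_ne f h
  rw [M.map_comp, (hM c).eq_of_tgt (M.map p) 0, zero_comp]

/-- Modules that vanish on the constant tuples are determined by their dimensions. -/
theorem nonempty_iso_of_finrank_eq {m : ℕ} {M N : CompMod k n m}
    (hM : ∀ c, IsZero (M.obj (compObj (constTuple n m c))))
    (hN : ∀ c, IsZero (N.obj (compObj (constTuple n m c))))
    (h : ∀ x, Module.finrank k (M.obj x) = Module.finrank k (N.obj x)) : Nonempty (M ≅ N) := by
  refine ⟨NatIso.ofComponents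
    (fun x => LinearEquiv.toFGModuleCatIso (LinearEquiv.ofFinrankEq _ _ (h x))) fun {x y} f => ?_⟩
  by_cases hxy : x = y
  · subst hxy
    rw [Subsingleton.elim f (𝟙 x), M.map_id, N.map_id, Category.id_comp, Category.comp_id]
  · rw [map_eq_zero_of_ne hM f hxy, map_eq_zero_of_ne hN f hxy, zero_comp, comp_zero]

open Classical in
/-- The module with given dimensions, and with vanishing maps between distinct objects. -/
def discreteModule (k : Type u) [Field k] {m : ℕ} (F : CompCat n m → ℕ) : CompMod k n m where
  obj x := FGModuleCat.of k (ULift.{u} (Fin (F x)) → k)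
  map {x y} _ := if h : x = y then eqToHom (by rw [h]) else 0
  map_id x := by simp
  map_comp {x y z} f g := by
    by_cases hxy : x = y
    · subst hxy
      by_cases hyz : x = z
      · subst hyz; simp
      · simp [hyz]
    · by_cases hyz : y = z
      · subst hyz; simp [hxy]
      · have hxz : x ≠ z := fun h => hxy (by subst h; exact compCat_antisymm f g)
        simp [hxy, hyz, hxz]

theorem finrank_discreteModule {m : ℕ} (F : CompCat n m → ℕ) (x : CompCat n m) :
    Module.finrank k ((discreteModule k F).obj x) = F x := by
  change Module.finrank k (ULift.{u} (Fin (F x)) → k) = F x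
  simp

/-- The classes that vanish in dimension zero. -/
def vanishing (k : Type u) [Field k] (n m : ℕ) : AddSubgroup (SplitGr (CompMod k n m)) :=
  (SplitGr.map (toImage (toZero k (compEnvelope (Fin (n + 1))) ⦋m⦌))).ker

/-- The dimension vector, as a function of tuples. -/
def tupleDim {m : ℕ} : SplitGr (CompMod k n m) →+ (ComposableArrows (Fin (n + 1)) m → ℤ) where
  toFun z x := dimVec k _ z (compObj x)
  map_zero' := by ext; simp
  map_add' _ _ := by ext; simp

theorem tupleDim_apply {m : ℕ} (z : SplitGr (CompMod k n m)) (x : ComposableArrows (Fin (n + 1)) m) :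
    tupleDim z x = dimVec k _ z (compObj x) := rfl

theorem exists_of_mem_vanishing {m : ℕ} {z : SplitGr (CompMod k n m)} (hz : z ∈ vanishing k n m) :
    ∃ M N : CompMod k n m, (∀ c, IsZero (M.obj (compObj (constTuple n m c)))) ∧
      (∀ c, IsZero (N.obj (compObj (constTuple n m c)))) ∧
      z = Algebra.GrothendieckAddGroup.of (IsoClass.mk M) -
        Algebra.GrothendieckAddGroup.of (IsoClass.mk N) := by
  obtain ⟨M, N, hM, hN, h⟩ := exists_of_map_toImage_eq_zero k (compEnvelope (Fin (n + 1))) ⦋m⦌ z hz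
  exact ⟨M, N, (isZero_toZero_iff M).1 hM, (isZero_toZero_iff N).1 hN, h⟩

theorem tupleDim_constTuple {m : ℕ} {z : SplitGr (CompMod k n m)} (hz : z ∈ vanishing k n m)
    (c : Fin (n + 1)) : tupleDim z (constTuple n m c) = 0 := by
  obtain ⟨M, N, hM, hN, rfl⟩ := exists_of_mem_vanishing hz
  rw [tupleDim_apply, map_sub, Pi.sub_apply, dimVec_of, dimVec_of,
    FGModuleCat.finrank_of_isZero k (hM c), FGModuleCat.finrank_of_isZero k (hN c), sub_self]

/-- Both modules in the difference can be chosen to vanish on constant tuples, and such modules are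
determined by their dimensions. -/
theorem eq_zero_of_tupleDim_eq_zero {m : ℕ} {z : SplitGr (CompMod k n m)}
    (hz : z ∈ vanishing k n m) (h : tupleDim z = 0) : z = 0 := by
  obtain ⟨M, N, hM, hN, rfl⟩ := exists_of_mem_vanishing hz
  have hdim : ∀ x, Module.finrank k (M.obj x) = Module.finrank k (N.obj x) := by
    intro x
    have := congrFun h (tuple x)
    rw [tupleDim_apply, map_sub, Pi.sub_apply, compObj_tuple, dimVec_of, dimVec_of,
      Pi.zero_apply, sub_eq_zero] at this
    exact_mod_cast this
  rw [IsoClass.mk_eq_mk_iff.2 (nonempty_iso_of_finrank_eq hM hN hdim), sub_self]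

theorem discreteModule_mem_vanishing {m : ℕ} {F : CompCat n m → ℕ}
    (hF : ∀ c, F (compObj (constTuple n m c)) = 0) :
    Algebra.GrothendieckAddGroup.of (IsoClass.mk (discreteModule k F)) ∈ vanishing k n m := by
  rw [vanishing, AddMonoidHom.mem_ker, SplitGr.map_of, IsoClass.mk_eq_zero, map_zero]
  refine isZero_toImage ((isZero_toZero_iff _).2 fun c => FGModuleCat.isZero_of_finrank k ?_)
  rw [finrank_discreteModule, hF]

/-- The positive and negative parts of `F` are dimension functions of discrete modules. With
`eq_zero_of_tupleDim_eq_zero` this identifies the vanishing classes with functions on non-constant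
tuples. -/
theorem exists_tupleDim_eq {m : ℕ} (F : ComposableArrows (Fin (n + 1)) m → ℤ)
    (hF : ∀ c, F (constTuple n m c) = 0) : ∃ z ∈ vanishing k n m, tupleDim z = F := by
  refine ⟨Algebra.GrothendieckAddGroup.of
      (IsoClass.mk (discreteModule k fun x => (F (tuple x)).toNat)) -
    Algebra.GrothendieckAddGroup.of
      (IsoClass.mk (discreteModule k fun x => (-F (tuple x)).toNat)),
    sub_mem (discreteModule_mem_vanishing fun c => ?_) (discreteModule_mem_vanishing fun c => ?_),
    funext fun x => ?_⟩
  · rw [tuple_compObj, hF, Int.toNat_zero]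
  · rw [tuple_compObj, hF, neg_zero, Int.toNat_zero]
  · rw [tupleDim_apply, map_sub, Pi.sub_apply, dimVec_of, dimVec_of, finrank_discreteModule,
      finrank_discreteModule, tuple_compObj]
    omega

/-- The coboundary on functions of tuples. -/
def tupleD {m : ℕ} (F : ComposableArrows (Fin (n + 1)) m → ℤ)
    (y : ComposableArrows (Fin (n + 1)) (m + 1)) : ℤ :=
  ∑ i : Fin (m + 2), (-1) ^ (i : ℕ) * F (face i y)

theorem tupleDim_altSum {m : ℕ} (z : SplitGr (CompMod k n m)) :
    tupleDim (altSum (coface k (compEnvelope (Fin (n + 1)))) m z) = tupleD (tupleDim z) := by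
  funext y
  rw [altSum_apply, map_sum, Finset.sum_apply, tupleD]
  refine Finset.sum_congr rfl fun i _ => ?_
  rw [map_zsmul, Pi.smul_apply, smul_eq_mul, tupleDim_apply, dimVec_map]
  rfl

end CompEnvelope

/-! ### Cocycles on tuples -/

section TupleCocycles

variable {n : ℕ}

theorem face_constTuple {m : ℕ} (i : Fin (m + 2)) (c : Fin (n + 1)) :
    face i (constTuple n (m + 1) c) = constTuple n m c :=
  composableArrows_ext fun _ => rfl

theorem eq_constTuple_zero (x : ComposableArrows (Fin (n + 1)) 0) :
    x = constTuple n 0 (x.obj 0) :=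
  composableArrows_ext fun i => by
    obtain rfl : i = 0 := Fin.fin_one_eq_zero i
    rfl

/-- A cocycle is the coboundary of its composite with `prepend`. -/
theorem tupleD_comp_prepend {m : ℕ} {F : ComposableArrows (Fin (n + 1)) (m + 1) → ℤ}
    (hF : tupleD F = 0) : tupleD (fun z => F (prepend z)) = F := by
  funext y
  have h := congrFun hF (prepend y)
  simp only [tupleD, Fin.sum_univ_succ (n := m + 2), face_zero_prepend, face_succ_prepend,
    Fin.val_zero, pow_zero, one_mul, Fin.val_succ, pow_succ, mul_neg_one, neg_mul,
    Finset.sum_neg_distrib, Pi.zero_apply] at h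
  rw [tupleD]
  exact (add_neg_eq_zero.1 h).symm

/-- Faces `0` and `1` both give `u (y.obj 2)` and cancel. The remaining `p + 1` faces all give `u
(y.obj 1)` with alternating signs, an even number of terms. -/
theorem tupleD_obj_one {p : ℕ} (hp : Odd p) (u : Fin (n + 1) → ℤ) :
    tupleD (fun z : ComposableArrows (Fin (n + 1)) (p + 1) => u (z.obj 1)) = 0 := by
  funext y
  have h1 : (face 0 y).obj 1 = y.obj 2 := rfl
  have h2 : (face 1 y).obj 1 = y.obj 2 := rfl
  have h3 : ∀ j : Fin (p + 1), (face j.succ.succ y).obj 1 = y.obj 1 := fun j => by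
    rw [face_obj, ← Fin.succ_zero_eq_one, Fin.succ_succAbove_succ, Fin.succ_succAbove_zero]
    rfl
  rw [tupleD, Fin.sum_univ_succ, Fin.sum_univ_succ, Fin.succ_zero_eq_one, h1, h2]
  simp only [h3, Fin.val_succ, pow_succ, mul_neg_one, neg_neg, ← Finset.sum_mul]
  rw [Fin.sum_neg_one_pow, if_pos hp.add_one]
  simp

/-- In degrees at least two, a cocycle that vanishes on the constant tuples is the coboundary of a
cochain that vanishes on the constant tuples. -/
theorem exists_tupleD_eq {p : ℕ} {F : ComposableArrows (Fin (n + 1)) (p + 2) → ℤ}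
    (hF : tupleD F = 0) (hc : ∀ c, F (constTuple n (p + 2) c) = 0) :
    ∃ E : ComposableArrows (Fin (n + 1)) (p + 1) → ℤ,
      (∀ c, E (constTuple n (p + 1) c) = 0) ∧ tupleD E = F := by
  have hE := tupleD_comp_prepend hF
  rcases Nat.even_or_odd p with hp | hp
  -- For `p` even the coboundary has `p + 3` terms, an odd number. On constant tuples it is the
  -- identity, so the cochain vanishes there because `F` does.
  · refine ⟨_, fun c => ?_, hE⟩
    have h := congrFun hE (constTuple n (p + 2) c)
    simp only [tupleD, face_constTuple, hc, ← Finset.sum_mul] at h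
    rw [Fin.sum_neg_one_pow, if_neg (by grind), one_mul] at h
    exact h
  -- For `p` odd the values on constant tuples are subtracted through entry `1`, which adds a
  -- cocycle by `tupleD_obj_one`. Entry `0` would leave a difference of two entries.
  · refine ⟨fun z => F (prepend z) - F (prepend (constTuple n (p + 1) (z.obj 1))), fun c => ?_, ?_⟩
    · exact sub_self _
    · funext y
      have h := congrFun (tupleD_obj_one hp fun c => F (prepend (constTuple n (p + 1) c))) y
      rw [← congrFun hE y]
      simp only [tupleD, Pi.zero_apply] at h ⊢
      simp only [mul_sub, Finset.sum_sub_distrib, h, sub_zero]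

/-- The cocycles of degree one that are given by a function of the nonzero entries. -/
def differenceCocycle (n : ℕ) : (Fin n → ℤ) →+ (ComposableArrows (Fin (n + 1)) 1 → ℤ) where
  toFun v := tupleD fun z => (Fin.cons 0 v : Fin (n + 1) → ℤ) (z.obj 0)
  map_zero' := by
    have h : (Fin.cons 0 0 : Fin (n + 1) → ℤ) = 0 := by
      funext i; induction i using Fin.cases <;> rfl
    funext y
    simp [h, tupleD]
  map_add' v w := by
    have h : (Fin.cons 0 (v + w) : Fin (n + 1) → ℤ) = Fin.cons 0 v + Fin.cons 0 w := by
      funext i; induction i using Fin.cases <;> simp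
    funext y
    simp only [h, tupleD, Pi.add_apply, mul_add, Finset.sum_add_distrib]

theorem differenceCocycle_apply (v : Fin n → ℤ) (y : ComposableArrows (Fin (n + 1)) 1) :
    differenceCocycle n v y =
      (Fin.cons 0 v : Fin (n + 1) → ℤ) (y.obj 1) - (Fin.cons 0 v : Fin (n + 1) → ℤ) (y.obj 0) := by
  change tupleD (fun z : ComposableArrows (Fin (n + 1)) 0 =>
    (Fin.cons 0 v : Fin (n + 1) → ℤ) (z.obj 0)) y = _
  rw [tupleD, Fin.sum_univ_two, Fin.val_zero, Fin.val_one, pow_zero, pow_one, one_mul, neg_one_mul,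
    ← sub_eq_add_neg]
  rfl

theorem tupleD_differenceCocycle (v : Fin n → ℤ) : tupleD (differenceCocycle n v) = 0 := by
  funext y
  have h1 : (face 0 y).obj 0 = y.obj 1 := rfl
  have h2 : (face 0 y).obj 1 = y.obj 2 := rfl
  have h3 : (face 1 y).obj 0 = y.obj 0 := rfl
  have h4 : (face 1 y).obj 1 = y.obj 2 := rfl
  have h5 : (face 2 y).obj 0 = y.obj 0 := rfl
  have h6 : (face 2 y).obj 1 = y.obj 1 := rfl
  rw [tupleD, Fin.sum_univ_three]
  simp only [differenceCocycle_apply, h1, h2, h3, h4, h5, h6,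
    Pi.zero_apply, Fin.val_zero, Fin.val_one, Fin.val_two]
  ring

theorem differenceCocycle_constTuple (v : Fin n → ℤ) (c : Fin (n + 1)) :
    differenceCocycle n v (constTuple n 1 c) = 0 := by
  rw [differenceCocycle_apply, constTuple_obj, constTuple_obj, sub_self]

theorem differenceCocycle_injective : Function.Injective (differenceCocycle n) := by
  rw [injective_iff_map_eq_zero]
  intro v hv
  funext i
  -- The pair `(0, i.succ)` recovers the coordinate `v i`, since the function is normalised to
  -- vanish at the least element.
  have h := congrFun hv (prepend (constTuple n 0 i.succ))
  have h1 : (prepend (constTuple n 0 i.succ)).obj 1 = i.succ := rfl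
  rw [differenceCocycle_apply, prepend_obj_zero, h1, Fin.cons_succ, Fin.cons_zero, sub_zero] at h
  exact h

/-- The cocycle `F` is the coboundary of `c ↦ F (0, c)`. This function vanishes at `c = 0` because
`(0, 0)` is constant, so only `n` values are free. -/
theorem exists_differenceCocycle_eq {F : ComposableArrows (Fin (n + 1)) 1 → ℤ}
    (hF : tupleD F = 0) (hc : ∀ c, F (constTuple n 1 c) = 0) :
    ∃ v, differenceCocycle n v = F := by
  refine ⟨fun i => F (prepend (constTuple n 0 i.succ)), ?_⟩
  refine Eq.trans (?_ : _ = tupleD fun z => F (prepend z)) (tupleD_comp_prepend hF)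
  refine congrArg (tupleD (m := 0)) (funext fun z => ?_ : (fun z : ComposableArrows _ 0 =>
    (Fin.cons 0 fun i => F (prepend (constTuple n 0 i.succ)) : Fin (n + 1) → ℤ) (z.obj 0)) = _)
  conv_rhs => rw [eq_constTuple_zero z]
  generalize z.obj 0 = c
  induction c using Fin.cases with
  | zero =>
    rw [Fin.cons_zero, ← hc 0]
    refine congrArg F (composableArrows_ext fun i => ?_)
    induction i using Fin.cases <;> rfl
  | succ c => rw [Fin.cons_succ]

end TupleCocycles

/-! ### Modules with isomorphic faces -/

section ConstantModules

open Opposite Simplicial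

variable {k : Type u} [Field k] {n : ℕ}

/-- The vertex of the compositional envelope given by an element of `[n]`. -/
abbrev vertex (c : Fin (n + 1)) : CompCat n 0 := compObj (constTuple n 0 c)

/-- The morphism of vertices out of the least element. -/
def fromZero (c : Fin (n + 1)) : vertex (0 : Fin (n + 1)) ⟶ vertex c :=
  compHom (Fin.zero_le c)

theorem isIso_map_congr {M : CompMod k n 0} {x x' y y' : CompCat n 0} (hx : x = x') (hy : y = y')
    (f : x ⟶ y) (g : x' ⟶ y') (h : IsIso (M.map f)) : IsIso (M.map g) := by
  subst hx hy
  rwa [Subsingleton.elim g f]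

theorem isIso_map_of_eq {x y : CompCat n 0} {f : x ⟶ y} (h : x = y) (M : CompMod k n 0) :
    IsIso (M.map f) :=
  isIso_map_congr rfl h (𝟙 x) f (by rw [M.map_id]; infer_instance)

/-- Lift the isomorphism to `f`, invertible on constant tuples. On `y = (0, c)` it is a map from `M
c` to `M 0`. Naturality along `(0, 0) ⟶ y` makes `M (0 ⟶ c)` followed by `f_y` invertible, so `f_y`
is split epi. Naturality along `y ⟶ (c, c)` makes `f_y` mono. So `f_y`, and with it `M (0 ⟶ c)`, is
invertible. -/
theorem isIso_map_fromZero {M : CompMod k n 0}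
    (h : Nonempty ((toImage (toZero k (compEnvelope (Fin (n + 1))) ⦋1⦌)).obj
        ((pull k _ (SimplexCategory.δ 0)).obj M) ≅
      (toImage (toZero k (compEnvelope (Fin (n + 1))) ⦋1⦌)).obj
        ((pull k _ (SimplexCategory.δ 1)).obj M)))
    (c : Fin (n + 1)) : IsIso (M.map (fromZero c)) := by
  obtain ⟨e⟩ := h
  obtain ⟨f, hf⟩ := (toImage (toZero k (compEnvelope (Fin (n + 1))) ⦋1⦌)).map_surjective e.hom
  obtain ⟨g, hg⟩ := (toImage (toZero k (compEnvelope (Fin (n + 1))) ⦋1⦌)).map_surjective e.inv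
  have hfg : (toZero k (compEnvelope (Fin (n + 1))) ⦋1⦌).map (f ≫ g) =
      (toZero k (compEnvelope (Fin (n + 1))) ⦋1⦌).map (𝟙 _) := by
    refine toImage_map_eq_iff.1 ?_
    rw [Functor.map_comp, hf, hg, e.hom_inv_id, CategoryTheory.Functor.map_id]
  have hgf : (toZero k (compEnvelope (Fin (n + 1))) ⦋1⦌).map (g ≫ f) =
      (toZero k (compEnvelope (Fin (n + 1))) ⦋1⦌).map (𝟙 _) := by
    refine toImage_map_eq_iff.1 ?_
    rw [Functor.map_comp, hf, hg, e.inv_hom_id, CategoryTheory.Functor.map_id]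
  have hiso : ∀ d : Fin (n + 1), IsIso (f.app (compObj (constTuple n 1 d))) := fun d =>
    ⟨g.app (compObj (constTuple n 1 d)), NatTrans.congr_app hfg (vertex d),
      NatTrans.congr_app hgf (vertex d)⟩
  let y : CompCat n 1 := compObj (prepend (constTuple n 0 c))
  let p : compObj (constTuple n 1 0) ⟶ y := compHom le_rfl
  let q : y ⟶ compObj (constTuple n 1 c) := compHom le_rfl
  have h1 := f.naturality p
  have h2 := f.naturality q
  have : IsIso (((pull k _ (SimplexCategory.δ 1)).obj M).map p) :=
    isIso_map_of_eq (compCat_ext fun i => by obtain rfl := Fin.fin_one_eq_zero i; rfl) M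
  have : IsIso (((pull k _ (SimplexCategory.δ 0)).obj M).map q) :=
    isIso_map_of_eq (compCat_ext fun i => by obtain rfl := Fin.fin_one_eq_zero i; rfl) M
  have : IsSplitEpi (f.app y) := IsSplitEpi.mk'
    ⟨inv (f.app _ ≫ ((pull k _ (SimplexCategory.δ 1)).obj M).map p) ≫
      ((pull k _ (SimplexCategory.δ 0)).obj M).map p, by
        rw [Category.assoc, h1, IsIso.inv_hom_id]⟩
  have : Mono (f.app y) := by
    have : Mono (f.app y ≫ ((pull k _ (SimplexCategory.δ 1)).obj M).map q) := by
      rw [← h2]; infer_instance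
    exact mono_of_mono _ (((pull k _ (SimplexCategory.δ 1)).obj M).map q)
  have : IsIso (f.app y) := isIso_of_mono_of_isSplitEpi _
  have : IsIso (((pull k _ (SimplexCategory.δ 0)).obj M).map p ≫ f.app y) := by
    rw [h1]; infer_instance
  have := IsIso.of_isIso_comp_right (((pull k _ (SimplexCategory.δ 0)).obj M).map p) (f.app y)
  exact isIso_map_congr (M := M) (compCat_ext fun i => by obtain rfl := Fin.fin_one_eq_zero i; rfl)
    (compCat_ext fun i => by obtain rfl := Fin.fin_one_eq_zero i; rfl) _ _ this

/-- The maps out of the least vertex form a cone, natural because morphisms between vertices are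
unique. -/
theorem nonempty_iso_const {M : CompMod k n 0} (h : ∀ c, IsIso (M.map (fromZero c))) :
    Nonempty ((Functor.const _).obj (M.obj (vertex 0)) ≅ M) := by
  have hx : ∀ x : CompCat n 0, x = vertex ((tuple x).obj 0) := fun x =>
    congrArg compObj (eq_constTuple_zero (tuple x))
  have h' : ∀ x : CompCat n 0, ∃ g : vertex 0 ⟶ x, IsIso (M.map g) := fun x => by
    rw [hx x]
    exact ⟨_, h _⟩
  choose g hg using h'
  refine ⟨NatIso.ofComponents (fun x => @asIso _ _ _ _ (M.map (g x)) (hg x)) fun {x y} f => ?_⟩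
  change 𝟙 _ ≫ M.map (g y) = M.map (g x) ≫ M.map f
  rw [Category.id_comp, ← M.map_comp, Subsingleton.elim (g y) (g x ≫ f)]

end ConstantModules

/-! ### The cohomology of the compositional envelope of `[n]` -/

section CompEnvelopeCohomology

open Opposite Simplicial

variable (k : Type u) [Field k]

theorem redCoface_map_toImage (X : SimplicialObject Cat.{v, w}) (m : ℕ) (i : Fin (m + 2))
    (a : SplitGr (ModAt k X ⦋m⦌)) :
    redCoface k X m i (SplitGr.map (toImage (toZero k X ⦋m⦌)) a) =
      SplitGr.map (toImage (toZero k X ⦋m + 1⦌)) (coface k X m i a) := by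
  refine DFunLike.congr_fun (f := (redCoface k X m i).comp (SplitGr.map (toImage (toZero k X ⦋m⦌))))
    (g := (SplitGr.map (toImage (toZero k X ⦋m + 1⦌))).comp (coface k X m i))
    (SplitGr.hom_ext fun M => ?_) a
  simp only [AddMonoidHom.comp_apply, coface, SplitGr.map_of]
  rfl

theorem altSum_redCoface_map_toImage (X : SimplicialObject Cat.{v, w}) (m : ℕ)
    (a : SplitGr (ModAt k X ⦋m⦌)) :
    altSum (redCoface k X) m (SplitGr.map (toImage (toZero k X ⦋m⦌)) a) =
      SplitGr.map (toImage (toZero k X ⦋m + 1⦌)) (altSum (coface k X) m a) := by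
  simp only [altSum_apply, map_sum, map_zsmul, redCoface_map_toImage]

theorem map_toImage_surjective (X : SimplicialObject Cat.{v, w}) (m : ℕ) :
    Function.Surjective (SplitGr.map (toImage (toZero k X ⦋m⦌))) :=
  SplitGr.map_surjective_of_obj _ fun Y => ⟨Y.as, rfl⟩

variable {k} {n : ℕ}

theorem altSum_mem_vanishing_iff {m : ℕ} (a : SplitGr (CompMod k n m)) :
    altSum (coface k (compEnvelope (Fin (n + 1)))) m a ∈ vanishing k n (m + 1) ↔
      altSum (redCoface k (compEnvelope (Fin (n + 1)))) m (SplitGr.map (toImage _) a) = 0 := by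
  rw [altSum_redCoface_map_toImage]
  rfl

theorem isKrullSchmidt_redMod_compEnvelope (n m : ℕ) :
    IsKrullSchmidt (RedMod k (compEnvelope (Fin (n + 1))) ⦋m⦌) :=
  isKrullSchmidt_redMod k _ _

/-- A cocycle of positive degree is cohomologous to one that vanishes in dimension zero. -/
theorem exists_sub_altSum_mem_vanishing {m : ℕ} {a : SplitGr (CompMod k n (m + 1))}
    (ha : altSum (coface k (compEnvelope (Fin (n + 1)))) (m + 1) a = 0) :
    ∃ b, a - altSum (coface k (compEnvelope (Fin (n + 1)))) m b ∈ vanishing k n (m + 1) := by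
  obtain ⟨q, hq⟩ := exact_redCoface k _ (isKrullSchmidt_redMod_compEnvelope n) m
    (SplitGr.map (toImage (toZero k (compEnvelope (Fin (n + 1))) ⦋m + 1⦌)) a)
    (by rw [altSum_redCoface_map_toImage, ha, map_zero])
  obtain ⟨b, rfl⟩ := map_toImage_surjective k _ m q
  refine ⟨b, ?_⟩
  rw [vanishing, AddMonoidHom.mem_ker, map_sub, ← altSum_redCoface_map_toImage, hq, sub_self]

/-- In dimension zero, a class with equal reduced faces is a multiple of the constant class. -/
theorem exists_eq_zsmul_constClass {a : SplitGr (CompMod k n 0)}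
    (ha : altSum (coface k (compEnvelope (Fin (n + 1)))) 0 a ∈ vanishing k n 1) :
    ∃ z : ℤ, a = z • constClass k _ := by
  have h : SplitGr.map (toImage (toZero k (compEnvelope (Fin (n + 1))) ⦋0⦌)) a ∈
      AddSubgroup.zmultiples (SplitGr.map (toImage (toZero k (compEnvelope (Fin (n + 1))) ⦋0⦌))
        (constClass k _)) := by
    refine (AddSubgroup.closure_le _).2 ?_ (mem_closure_of_redCoface k _
      (isKrullSchmidt_redMod_compEnvelope n) _ ((altSum_mem_vanishing_iff a).1 ha))
    rintro _ ⟨M, hM, rfl⟩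
    have hM' := nonempty_iso_const (isIso_map_fromZero hM)
    refine ⟨(Module.finrank k (M.obj (vertex 0)) : ℤ), ?_⟩
    change (Module.finrank k (M.obj (vertex 0)) : ℤ) • _ = _
    rw [← map_zsmul, natCast_zsmul, ← of_mk_const, IsoClass.mk_eq_mk_iff.2 hM', SplitGr.map_of]
  obtain ⟨z, hz⟩ := h
  -- In dimension zero every tuple is constant, so the only vanishing class is zero.
  have hmem : a - z • constClass k _ ∈ vanishing k n 0 := by
    rw [vanishing, AddMonoidHom.mem_ker, map_sub, map_zsmul, sub_eq_zero]
    exact hz.symm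
  refine ⟨z, sub_eq_zero.1 (eq_zero_of_tupleDim_eq_zero hmem (funext fun x => ?_))⟩
  rw [eq_constTuple_zero x]
  exact tupleDim_constTuple hmem _

theorem nonempty_compEnvelopeCohomology_zero (k : Type u) [Field k] (n : ℕ) :
    Nonempty (compEnvelopeCohomology (Fin (n + 1)) k 0 ≃+ ℤ) := by
  have : Nonempty ((compEnvelope (Fin (n + 1))).obj (op ⦋0⦌)) := ⟨vertex 0⟩
  exact nonempty_repCohomology_zero_addEquiv_int k _ fun a ha =>
    exists_eq_zsmul_constClass (ha ▸ zero_mem _)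

/-- The connecting map into the first cohomology of the vanishing classes is zero: a reduced
0-cocycle comes from a multiple of the constant class, a cocycle already before reduction. -/
theorem altSum_coface_zero_eq_zero {b : SplitGr (CompMod k n 0)}
    (hb : altSum (coface k (compEnvelope (Fin (n + 1)))) 0 b ∈ vanishing k n 1) :
    altSum (coface k (compEnvelope (Fin (n + 1)))) 0 b = 0 := by
  obtain ⟨z, rfl⟩ := exists_eq_zsmul_constClass hb
  rw [map_zsmul, altSum_apply, Fin.sum_univ_two, coface_constClass, coface_constClass]
  simp

theorem altSum_coface_mem_vanishing {m : ℕ} {z : SplitGr (CompMod k n m)}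
    (hz : z ∈ vanishing k n m) :
    altSum (coface k (compEnvelope (Fin (n + 1)))) m z ∈ vanishing k n (m + 1) := by
  rw [altSum_mem_vanishing_iff, (AddMonoidHom.mem_ker).1 hz, map_zero]

theorem altSum_coface_altSum {m : ℕ} (X : SimplicialObject Cat.{v, w})
    (a : SplitGr (ModAt k X ⦋m⦌)) : altSum (coface k X) (m + 1) (altSum (coface k X) m a) = 0 := by
  rw [← repComplex_d_apply, ← repComplex_d_apply]
  exact DFunLike.congr_fun (congrArg AddCommGrpCat.Hom.hom
    ((repComplex k X).d_comp_d m (m + 1) (m + 2))) a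

/-- Exactness of the reduced complex moves a cocycle into the vanishing classes, where
`exists_tupleD_eq` bounds its dimension function. Bounding is then checked on dimensions alone. -/
theorem subsingleton_compEnvelopeCohomology (k : Type u) [Field k] (n p : ℕ) :
    Subsingleton (compEnvelopeCohomology (Fin (n + 1)) k (p + 2)) := by
  refine subsingleton_repCohomology_succ k _ (p + 1) fun a ha => ?_
  obtain ⟨b, hb⟩ := exists_sub_altSum_mem_vanishing ha
  have hd := congrArg tupleDim (show altSum (coface k (compEnvelope (Fin (n + 1)))) (p + 2)
    (a - altSum (coface k (compEnvelope (Fin (n + 1)))) (p + 1) b) = 0 by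
      rw [map_sub, ha, altSum_coface_altSum, sub_zero])
  rw [tupleDim_altSum, map_zero] at hd
  obtain ⟨E, hE, hdE⟩ := exists_tupleD_eq hd (tupleDim_constTuple hb)
  obtain ⟨e, he, rfl⟩ := exists_tupleDim_eq (k := k) E hE
  refine ⟨b + e, ?_⟩
  rw [map_add, ← sub_eq_zero, ← neg_eq_zero]
  refine eq_zero_of_tupleDim_eq_zero (m := p + 2) (n := n) ?_ ?_
  · rw [neg_sub, ← sub_sub]
    exact sub_mem hb (altSum_coface_mem_vanishing he)
  · rw [neg_sub, ← sub_sub, map_sub, tupleDim_altSum, hdE, sub_self]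

/-- The class in dimension one, vanishing in dimension zero, with given dimension vector. -/
theorem exists_differenceClass (k : Type u) [Field k] (n : ℕ) :
    ∃ ψ : (Fin n → ℤ) →+ SplitGr (CompMod k n 1),
      ∀ v, ψ v ∈ vanishing k n 1 ∧ tupleDim (ψ v) = differenceCocycle n v := by
  choose s hs hs' using fun v => exists_tupleDim_eq (k := k) (differenceCocycle n v)
    (differenceCocycle_constTuple v)
  -- A vanishing class is determined by its dimensions, so the chosen lifts are automatically
  -- additive.
  refine ⟨AddMonoidHom.mk' s fun v w => sub_eq_zero.1 (eq_zero_of_tupleDim_eq_zero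
    (sub_mem (hs _) (add_mem (hs _) (hs _))) ?_), fun v => ⟨hs v, hs' v⟩⟩
  rw [map_sub, map_add, hs', hs', hs', map_add, sub_self]

theorem nonempty_compEnvelopeCohomology_one (k : Type u) [Field k] (n : ℕ) :
    Nonempty (compEnvelopeCohomology (Fin (n + 1)) k 1 ≃+ (Fin n → ℤ)) := by
  obtain ⟨ψ, hψ⟩ := exists_differenceClass k n
  refine nonempty_repCohomology_succ_addEquiv k _ 0 ψ (fun v => ?_) (fun a ha => ?_) fun v b h => ?_
  · refine eq_zero_of_tupleDim_eq_zero (m := 2) (altSum_coface_mem_vanishing (hψ v).1) ?_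
    rw [tupleDim_altSum, (hψ v).2, tupleD_differenceCocycle]
  · obtain ⟨b, hb⟩ := exists_sub_altSum_mem_vanishing ha
    have hd := congrArg tupleDim (show altSum (coface k (compEnvelope (Fin (n + 1)))) 1
      (a - altSum (coface k (compEnvelope (Fin (n + 1)))) 0 b) = 0 by
        rw [map_sub, ha, altSum_coface_altSum, sub_zero])
    rw [tupleDim_altSum, map_zero] at hd
    obtain ⟨v, hv⟩ := exists_differenceCocycle_eq hd (tupleDim_constTuple hb)
    refine ⟨v, b, sub_eq_iff_eq_add.1 (sub_eq_zero.1
      (eq_zero_of_tupleDim_eq_zero (sub_mem hb (hψ v).1) ?_))⟩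
    rw [map_sub, (hψ v).2, hv, sub_self]
  -- If `ψ v` is the coboundary of `b`, then `b` is a cocycle after reduction, so its coboundary is
  -- zero and `v = 0`.
  · have h0 := altSum_coface_zero_eq_zero (h ▸ (hψ v).1)
    rw [← h] at h0
    refine (injective_iff_map_eq_zero _).1 differenceCocycle_injective v ?_
    rw [← (hψ v).2, h0, map_zero]

end CompEnvelopeCohomology

end

end RepCohomology

theorem mainTheorem8 (k : Type*) [Field k] (n : ℕ) (hn : 2 ≤ n) :
    (Nonempty (RepCohomology.envelopeCohomology (Fin (n + 1)) k 0 ≃+ ℤ) ∧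
      ∀ i : ℕ, 0 < i → Subsingleton (RepCohomology.envelopeCohomology (Fin (n + 1)) k i)) ∧
    (Nonempty (RepCohomology.compEnvelopeCohomology (Fin (n + 1)) k 0 ≃+ ℤ) ∧
      Nonempty (RepCohomology.compEnvelopeCohomology (Fin (n + 1)) k 1 ≃+ (Fin n → ℤ)) ∧
      ∀ i : ℕ, 1 < i →
        Subsingleton (RepCohomology.compEnvelopeCohomology (Fin (n + 1)) k i)) := by
  refine ⟨⟨RepCohomology.nonempty_envelopeCohomology_zero k n, fun i hi => ?_⟩,
    RepCohomology.nonempty_compEnvelopeCohomology_zero k n,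
    RepCohomology.nonempty_compEnvelopeCohomology_one k n, fun i hi => ?_⟩
  · obtain ⟨m, rfl⟩ := Nat.exists_eq_succ_of_ne_zero hi.ne'
    exact RepCohomology.subsingleton_envelopeCohomology k n m
  · obtain ⟨p, rfl⟩ := Nat.exists_eq_add_of_le' hi
    exact RepCohomology.subsingleton_compEnvelopeCohomology k n p
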